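/- Let $M$ be a smooth $n$-manifold with a Finsler metric $F$ (smooth and positive on $TM\setminus 0$, positively $1$-homogeneous, with $g_{ij}=\frac12[F^2]_{y^iy^j}$ positive definite) and a measure $\mu$ given in local coordinates by $d\mu=\sigma(x)\,dx$ with $\sigma$ smooth and positive. In natural coordinates $(x^i,y^i)$ on $TM\setminus0$, with the summation convention and indices raised by $(g^{ij})=(g_{ij})^{-1}$, put $$G^i=\tfrac14 g^{ij}\{[F^2]_{y^jx^k}y^k-[F^2]_{x^j}\},\quad N^i_j=\frac{\partial G^i}{\partial y^j},\quad \frac{\delta}{\delta x^i}=\frac{\partial}{\partial x^i}-N^j_i\frac{\partial}{\partial y^j},\quad \Gamma^i_{jk}=\tfrac12 g^{il}\Big(\frac{\delta g_{jl}}{\delta x^k}+\frac{\delta g_{lk}}{\delta x^j}-\frac{\delta g_{jk}}{\delta x^l}\Big),$$ let $_{|i}$ denote the horizontal covariant derivative of the Chern connection (coefficients $\Gamma^i_{jk}$; $f_{|i}=\delta f/\delta x^i$ on functions), $T^{|i}=g^{ij}T_{|j}$, and let $$C_{ijk}=\tfrac14[F^2]_{y^iy^jy^k},\qquad L^i_{jk}=[G^i]_{y^jy^k}-\Gamma^i_{jk},\qquad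 R_j{}^i{}_{kl}=\frac{\delta\Gamma^i_{jl}}{\delta x^k}-\frac{\delta\Gamma^i_{jk}}{\delta x^l}+\Gamma^i_{km}\Gamma^m_{jl}-\Gamma^i_{lm}\Gamma^m_{jk},\qquad R^i{}_{kl}=y^jR_j{}^i{}_{kl}$$ be the Cartan tensor, the Landsberg tensor, the Chern–Riemann curvature and the flag curvature tensor. Put $\bar R_{ij}=g^{kl}g_{ih}R_k{}^h{}_{jl}$, let $R=g^{ij}R_i{}^k{}_{kj}$ be the scalar curvature, $\tau=\log\frac{\sqrt{\det(g_{ij})}}{\sigma(x)}$ the distortion, and $F_y^2(\nabla\tau)=g^{ij}\tau_{|i}\tau_{|j}$. Suppose that $(M,F,\mu)$ is an essential gradient Ricci soliton (normalized to constant $\frac12$): for all $(x,y)\in TM\setminus 0$ and all $V\in T_xM$, $$(\bar R_{ij}+\tau_{|i|j})V^iV^j=\tfrac12\,g_{ij}V^iV^j .$$ Then on $TM\setminus 0$, in any natural coordinates and for every $m$, $$\tfrac12\big(R+F_y^2(\nabla\tau)-\tau\big)_{|m}+\tau^{|i}\big(C^t_{ms}R^s{}_{ti}-C^t_{is}R^s{}_{tm}\big)=K_m,$$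 where $$K_m=(C^t_{ms}R^s{}_{ti})^{|i}+\big(C^t_{ms}{}^{|i}-C^t_{ml}L^{li}{}_s\big)R^s{}_{ti}+\big(C^t_{il}L^{li}{}_s-C^t_{is}{}^{|i}\big)R^s{}_{tm}.$$ -/

import Mathlib

open scoped Manifold ContDiff

noncomputable section

namespace Finsler

/-- The coordinate space `ℝⁿ`, used both for positions `x` and for directions `y`. -/
abbrev Coord (n : ℕ) := EuclideanSpace ℝ (Fin n)

/-- A function `f(x, y)` of a position and a direction in a coordinate domain. -/
abbrev LocalFun (n : ℕ) := Coord n → Coord n → ℝ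

section LocalCoordinates

variable {n : ℕ}

/-- `∂f/∂xⁱ`. -/
def dx (i : Fin n) (f : LocalFun n) : LocalFun n :=
  fun x y => fderiv ℝ (fun x' => f x' y) x (EuclideanSpace.single i 1)

/-- `∂f/∂yⁱ`. -/
def dy (i : Fin n) (f : LocalFun n) : LocalFun n :=
  fun x y => fderiv ℝ (fun y' => f x y') y (EuclideanSpace.single i 1)

/-- `F²`. -/
def sq (F : LocalFun n) : LocalFun n := fun x y => F x y ^ 2

/-- The fundamental tensor `g_{ij} = ½ ∂²F²/∂yⁱ∂yʲ`. -/
def g (F : LocalFun n) (i j : Fin n) : LocalFun n :=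
  fun x y => 1 / 2 * dy i (dy j (sq F)) x y

/-- The matrix `(g_{ij}(x, y))`. -/
def gMatrix (F : LocalFun n) (x y : Coord n) : Matrix (Fin n) (Fin n) ℝ :=
  Matrix.of fun i j => g F i j x y

/-- The inverse matrix `g^{ij}`. -/
def gInv (F : LocalFun n) (i j : Fin n) : LocalFun n :=
  fun x y => (gMatrix F x y)⁻¹ i j

/-- The Cartan tensor `C_{ijk} = ¼ ∂³F²/∂yⁱ∂yʲ∂yᵏ`. -/
def cartan (F : LocalFun n) (i j k : Fin n) : LocalFun n :=
  fun x y => 1 / 4 * dy i (dy j (dy k (sq F))) x y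

/-- `Cⁱ_{jk} = g^{il} C_{ljk}`. -/
def cartanUp (F : LocalFun n) (i j k : Fin n) : LocalFun n :=
  fun x y => ∑ l, gInv F i l x y * cartan F l j k x y

/-- The spray coefficients `Gⁱ = ¼ g^{ij} ([F²]_{yʲxᵏ} yᵏ - [F²]_{xʲ})`. -/
def spray (F : LocalFun n) (i : Fin n) : LocalFun n :=
  fun x y => 1 / 4 * ∑ j, gInv F i j x y *
    ((∑ k, dx k (dy j (sq F)) x y * y k) - dx j (sq F) x y)

/-- The nonlinear connection coefficients `Nⁱ_j = ∂Gⁱ/∂yʲ`. -/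
def nonlinConn (F : LocalFun n) (i j : Fin n) : LocalFun n :=
  dy j (spray F i)

/-- The horizontal derivative `δf/δxⁱ = ∂f/∂xⁱ - Nʲ_i ∂f/∂yʲ`; on functions this is `f_{|i}`. -/
def hd (F : LocalFun n) (i : Fin n) (f : LocalFun n) : LocalFun n :=
  fun x y => dx i f x y - ∑ j, nonlinConn F j i x y * dy j f x y

/-- The coefficients `Γⁱ_{jk} = ½ g^{il} (δg_{jl}/δxᵏ + δg_{lk}/δxʲ - δg_{jk}/δxˡ)` of the Chern
connection. -/
def chern (F : LocalFun n) (i j k : Fin n) : LocalFun n :=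
  fun x y => 1 / 2 * ∑ l, gInv F i l x y *
    (hd F k (g F j l) x y + hd F j (g F l k) x y - hd F l (g F j k) x y)

/-- The Chern-Riemann curvature; `riem F j i k l` is `R_j{}^i{}_{kl}`. -/
def riem (F : LocalFun n) (j i k l : Fin n) : LocalFun n :=
  fun x y => hd F k (chern F i j l) x y - hd F l (chern F i j k) x y
    + (∑ m, chern F i k m x y * chern F m j l x y)
    - ∑ m, chern F i l m x y * chern F m j k x y

/-- The flag curvature tensor with two lower indices, `Rⁱ_{kl} = yʲ R_j{}^i{}_{kl}`. -/
def flag (F : LocalFun n) (i k l : Fin n) : LocalFun n :=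
  fun x y => ∑ j, y j * riem F j i k l x y

/-- The Landsberg tensor `Lⁱ_{jk} = ∂²Gⁱ/∂yʲ∂yᵏ - Γⁱ_{jk}`. -/
def landsberg (F : LocalFun n) (i j k : Fin n) : LocalFun n :=
  fun x y => dy j (dy k (spray F i)) x y - chern F i j k x y

/-- `L^{ij}{}_k = g^{jl} Lⁱ_{lk}`. -/
def landsbergUp (F : LocalFun n) (i j k : Fin n) : LocalFun n :=
  fun x y => ∑ l, gInv F j l x y * landsberg F i l k x y

/-- Horizontal Chern covariant derivative of a covector, `T_{i|k}`. -/
def hcov1 (F : LocalFun n) (T : Fin n → LocalFun n) (i k : Fin n) : LocalFun n :=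
  fun x y => hd F k (T i) x y - ∑ l, chern F l i k x y * T l x y

/-- Horizontal Chern covariant derivative of a tensor with two lower indices, `T_{ij|k}`. -/
def hcov2 (F : LocalFun n) (T : Fin n → Fin n → LocalFun n) (i j k : Fin n) : LocalFun n :=
  fun x y => hd F k (T i j) x y - (∑ l, chern F l i k x y * T l j x y)
    - ∑ l, chern F l j k x y * T i l x y

/-- Horizontal Chern covariant derivative of a tensor with one upper (the first) and two lower
indices, `Tᵗ_{ij|k}`. -/
def hcov12 (F : LocalFun n) (T : Fin n → Fin n → Fin n → LocalFun n) (t i j k : Fin n) :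
    LocalFun n :=
  fun x y => hd F k (T t i j) x y + (∑ l, chern F t l k x y * T l i j x y)
    - (∑ l, chern F l i k x y * T t l j x y) - ∑ l, chern F l j k x y * T t i l x y

/-- `R̄_{ij} = g^{kl} g_{ih} R_k{}^h{}_{jl}`. -/
def ricBar (F : LocalFun n) (i j : Fin n) : LocalFun n :=
  fun x y => ∑ k, ∑ l, ∑ h, gInv F k l x y * g F i h x y * riem F k h j l x y

/-- The scalar curvature `R = g^{ij} R_i{}^k{}_{kj}`. -/
def scalarCurv (F : LocalFun n) : LocalFun n :=
  fun x y => ∑ i, ∑ j, ∑ k, gInv F i j x y * riem F i k k j x y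

/-- The distortion `τ = log (√det(g_{ij}) / σ(x))` for the measure `σ(x) dx`. -/
def distortion (F : LocalFun n) (σ : Coord n → ℝ) : LocalFun n :=
  fun x y => Real.log (Real.sqrt (gMatrix F x y).det / σ x)

/-- `f^{|i} = g^{ij} f_{|j}`. -/
def hgrad (F f : LocalFun n) (i : Fin n) : LocalFun n :=
  fun x y => ∑ j, gInv F i j x y * hd F j f x y

/-- `F_y²(∇f) = g^{ij} f_{|i} f_{|j}`, the squared `g_y`-norm of the horizontal derivative. -/
def hgradNormSq (F f : LocalFun n) : LocalFun n :=
  fun x y => ∑ i, ∑ j, gInv F i j x y * hd F i f x y * hd F j f x y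

/-- The weighted curvature `R̄^∞_{ij} = R̄_{ij} + τ_{|i|j}`. -/
def ricInfty (F : LocalFun n) (σ : Coord n → ℝ) (i j : Fin n) : LocalFun n :=
  fun x y => ricBar F i j x y + hcov1 F (fun k => hd F k (distortion F σ)) i j x y

/-- The one-form
`K_m = (Cᵗ_{ms} Rˢ_{ti})^{|i} + (Cᵗ_{ms}{}^{|i} - Cᵗ_{ml} L^{li}{}_s) Rˢ_{ti}
  + (Cᵗ_{il} L^{li}{}_s - Cᵗ_{is}{}^{|i}) Rˢ_{tm}`. -/
def keyForm (F : LocalFun n) (m : Fin n) : LocalFun n :=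
  fun x y =>
    (∑ i, ∑ j, gInv F i j x y *
      hcov2 F (fun a b x y => ∑ t, ∑ s, cartanUp F t a s x y * flag F s t b x y) m i j x y)
    + (∑ t, ∑ s, ∑ i,
        ((∑ j, gInv F i j x y * hcov12 F (cartanUp F) t m s j x y)
          - ∑ l, cartanUp F t m l x y * landsbergUp F l i s x y) * flag F s t i x y)
    + ∑ t, ∑ s, ∑ i,
        ((∑ l, cartanUp F t i l x y * landsbergUp F l i s x y)
          - ∑ j, gInv F i j x y * hcov12 F (cartanUp F) t i s j x y) * flag F s t m x y

end LocalCoordinates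

section Manifold

variable {n : ℕ} {M : Type*} [TopologicalSpace M] [ChartedSpace (Coord n) M]

/-- The expression `F_φ(x, y) = F(φ⁻¹(x), yⁱ ∂/∂xⁱ)` of a function `F` on the tangent bundle in
the natural coordinates induced by a chart `φ`. -/
def localRep (F : TangentBundle (𝓡 n) M → ℝ) (φ : OpenPartialHomeomorph M (Coord n)) :
    LocalFun n :=
  fun x y => F ⟨φ.symm x, mfderiv (𝓡 n) (𝓡 n) φ.symm x y⟩

variable (n M) in
/-- A Finsler metric on an `n`-dimensional smooth manifold. -/
structure FinslerMetric [IsManifold (𝓡 n) ∞ M] where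
  /-- the function on the tangent bundle -/
  toFun : TangentBundle (𝓡 n) M → ℝ
  nonneg : ∀ v, 0 ≤ toFun v
  pos : ∀ v : TangentBundle (𝓡 n) M, v.2 ≠ 0 → 0 < toFun v
  smooth : ContMDiffOn (𝓡 n).tangent 𝓘(ℝ, ℝ) ∞ toFun {v | v.2 ≠ 0}
  homogeneous : ∀ (p : M) (v : TangentSpace (𝓡 n) p) (k : ℝ), 0 < k →
    toFun ⟨p, k • v⟩ = k * toFun ⟨p, v⟩
  convex : ∀ φ ∈ IsManifold.maximalAtlas (𝓡 n) ∞ M, ∀ x ∈ φ.target, ∀ y : Coord n, y ≠ 0 →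
    (gMatrix (localRep toFun φ) x y).PosDef

variable (n M) in
/-- A measure which in every chart is `σ(x) dx` with a smooth positive function `σ`. (By continuity
`σ` is determined by the measure on the range of the chart; its values elsewhere are irrelevant.) -/
structure SmoothMeasure [IsManifold (𝓡 n) ∞ M] [MeasurableSpace M] where
  /-- the measure -/
  μ : MeasureTheory.Measure M
  /-- its density with respect to Lebesgue measure in a chart -/
  density : OpenPartialHomeomorph M (Coord n) → Coord n → ℝ
  smooth : ∀ φ ∈ IsManifold.maximalAtlas (𝓡 n) ∞ M, ContDiffOn ℝ ∞ (density φ) φ.target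
  pos : ∀ φ ∈ IsManifold.maximalAtlas (𝓡 n) ∞ M, ∀ x ∈ φ.target, 0 < density φ x
  map_eq : ∀ φ ∈ IsManifold.maximalAtlas (𝓡 n) ∞ M,
    (μ.restrict φ.source).map φ =
      (MeasureTheory.volume.restrict φ.target).withDensity (fun x => ENNReal.ofReal (density φ x))

/-- `(M, F, μ)` is an essential gradient Ricci soliton with constant `c`:
`Ric^∞_y(V, V) = c g_y(V, V)` for all `y ≠ 0` and all `V`, in the coordinates of every chart. -/
def IsEssentialGradientRicciSoliton [IsManifold (𝓡 n) ∞ M] [MeasurableSpace M]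
    (F : FinslerMetric n M) (μ : SmoothMeasure n M) (c : ℝ) : Prop :=
  ∀ φ ∈ IsManifold.maximalAtlas (𝓡 n) ∞ M, ∀ x ∈ φ.target, ∀ y : Coord n, y ≠ 0 →
    ∀ V : Coord n,
      ∑ i, ∑ j, ricInfty (localRep F.toFun φ) (μ.density φ) i j x y * V i * V j =
        c * ∑ i, ∑ j, g (localRep F.toFun φ) i j x y * V i * V j

end Manifold

end Finsler

end

/-!
The proof follows the contracted Bianchi identity of Riemannian Ricci solitons and keeps track of
the Cartan-tensor corrections.

In a chart everything takes place in the algebra of smooth functions on `U × (ℝⁿ \ 0)`. Only the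
commuting derivations `∂/∂xⁱ`, `∂/∂yⁱ`, Euler's relation for `F²` and the inverse of `g` matter, so
the tensor calculus is carried out in an abstract `FinslerAlgebra`, where there are no
differentiability side conditions; `localAlgebra` provides the instance.

Homogeneity enters once: it gives `Γⁱ_{jk} yʲ = Nⁱ_k` (`sum_Γ_mul_y`), so that the flag curvature is
the curvature of the horizontal distribution, `[δ_k, δ_l] = -Rˢ_{kl} ∂/∂yˢ` (`δ_δ`). Since
horizontal derivatives commute only up to vertical ones, three Riemannian identities acquire extra
terms: the curvature is skew in its first pair up to `-2 C_{ijs} Rˢ_{kl}` (`Rm_skew`), the second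
Bianchi identity contains `∂Γ/∂y` contracted with the flag curvature (`Rm_bianchi`), and the Ricci
identity for `τ_{|i}` contains the vertical derivative of `τ_{|i}` (`cov2_hess`). Both vertical
derivatives are expressed through `C_{ijs|m} - C_{ijt} Lᵗ_{ms}` (`sum_g_mul_Y_Γ`, `Y_t`), the latter
because `∂τ/∂yˢ` is the mean Cartan tensor, by Jacobi's formula.

The soliton equation prescribes only the symmetric part of `R̄_{ij} + τ_{|i|j}`. Its skew part is
`T_{ij} - T_{ji}` with `T_{ij} = Cᵗ_{is} Rˢ_{tj}`, because the mean Cartan terms of `Rb_sub_Rb` and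
`hess_sub_hess` cancel. Hence `R̄_{ij} = ½ g_{ij} + T_{ij} - T_{ji} - τ_{|i|j}`; inserting this and
the Ricci identity into `contracted_bianchi` makes the remaining mean Cartan terms cancel and leaves
the claim (`soliton_identity`).
-/

noncomputable section

namespace Finsler

open scoped Matrix

/-- The constant `1/2` of a real algebra. -/
def half (A : Type*) [CommRing A] [Algebra ℝ A] : A := algebraMap ℝ A (1 / 2)

/-- The algebra of functions of position and direction on which a Finsler metric is defined, reduced
to what tensor calculus uses: a commutative real algebra with commuting derivations `X i = ∂/∂xⁱ`
and `Y i = ∂/∂yⁱ`, the fibre coordinates `y i`, an element `Q = F²` satisfying Euler's relation for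
homogeneity of degree two, and an inverse `gi` of the matrix `½ ∂²Q/∂yⁱ∂yʲ`. -/
structure FinslerAlgebra (ι A : Type*) [Fintype ι] [DecidableEq ι] [CommRing A] [Algebra ℝ A] where
  X : ι → Derivation ℝ A A
  Y : ι → Derivation ℝ A A
  X_X : ∀ i j a, X i (X j a) = X j (X i a)
  Y_Y : ∀ i j a, Y i (Y j a) = Y j (Y i a)
  X_Y : ∀ i j a, X i (Y j a) = Y j (X i a)
  y : ι → A
  X_y : ∀ i j, X i (y j) = 0
  Y_y : ∀ i j, Y i (y j) = if i = j then 1 else 0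
  Q : A
  euler : ∑ k, y k * Y k Q = 2 * Q
  gi : ι → ι → A
  gi_mul_g : ∀ i k, ∑ j, gi i j * (half A * Y j (Y k Q)) = if i = k then 1 else 0

namespace FinslerAlgebra

variable {ι A : Type*} [Fintype ι] [DecidableEq ι] [CommRing A] [Algebra ℝ A]
  (S : FinslerAlgebra ι A)

/-! ### Preliminaries on derivations -/

lemma two_mul_half : 2 * half A = 1 := by
  rw [half, ← map_ofNat (algebraMap ℝ A) 2, ← map_mul]; norm_num

lemma eq_of_two_mul_eq {a b : A} (h : 2 * a = 2 * b) : a = b := by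
  linear_combination half A * h - (a - b) * two_mul_half (A := A)

@[simp] lemma derivation_half (D : Derivation ℝ A A) : D (half A) = 0 := D.map_algebraMap _

@[simp] lemma derivation_two (D : Derivation ℝ A A) : D (2 : A) = 0 := by
  simpa using D.map_natCast 2

omit [DecidableEq ι] in
lemma map_derivation_mul (D : Derivation ℝ A A) (M N : Matrix ι ι A) :
    (M * N).map D = M.map D * N + M * N.map D := by
  ext i j
  simp only [Matrix.map_apply, Matrix.mul_apply, Matrix.add_apply, map_sum, Derivation.leibniz,
    smul_eq_mul, ← Finset.sum_add_distrib]
  exact Finset.sum_congr rfl fun k _ => by ring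

/-! ### The tensors of Finsler geometry -/

/-- The fundamental tensor `g_{ij} = ½ ∂²Q/∂yⁱ∂yʲ`. -/
def g (i j : ι) : A := half A * S.Y i (S.Y j S.Q)

/-- The Cartan tensor `C_{ijk} = ¼ ∂³Q/∂yⁱ∂yʲ∂yᵏ`. -/
def C (i j k : ι) : A := half A * half A * S.Y i (S.Y j (S.Y k S.Q))

/-- The covector `Q_{yⁱxᵏ} yᵏ - Q_{xⁱ}`, which is four times the spray with its index lowered. -/
def s (i : ι) : A := (∑ k, S.X k (S.Y i S.Q) * S.y k) - S.X i S.Q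

/-- The spray coefficients `Gⁱ`. -/
def spray (i : ι) : A := half A * half A * ∑ j, S.gi i j * S.s j

/-- The nonlinear connection `Nⁱ_j = ∂Gⁱ/∂yʲ`. -/
def N (i j : ι) : A := S.Y j (S.spray i)

/-- The horizontal derivation `δ/δxⁱ = ∂/∂xⁱ - Nʲ_i ∂/∂yʲ`. -/
def δ (i : ι) : Derivation ℝ A A := S.X i - ∑ j, S.N j i • S.Y j

/-- The Chern connection coefficients `Γⁱ_{jk}`. -/
def Γ (i j k : ι) : A := half A * ∑ l, S.gi i l *
  (S.δ k (S.g j l) + S.δ j (S.g l k) - S.δ l (S.g j k))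

/-- The Chern-Riemann curvature; `riem j i k l` is `R_j{}^i{}_{kl}`. -/
def riem (j i k l : ι) : A := S.δ k (S.Γ i j l) - S.δ l (S.Γ i j k)
  + (∑ m, S.Γ i k m * S.Γ m j l) - ∑ m, S.Γ i l m * S.Γ m j k

/-- The flag curvature tensor `Rⁱ_{kl} = yʲ R_j{}^i{}_{kl}`. -/
def flag (i k l : ι) : A := ∑ j, S.y j * S.riem j i k l

/-- The Landsberg tensor `Lⁱ_{jk} = ∂²Gⁱ/∂yʲ∂yᵏ - Γⁱ_{jk}`. -/
def landsberg (i j k : ι) : A := S.Y j (S.Y k (S.spray i)) - S.Γ i j k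

lemma δ_apply (i : ι) (f : A) : S.δ i f = S.X i f - ∑ j, S.N j i * S.Y j f := by
  have h := map_sum (⟨⟨fun D : Derivation ℝ A A => D f, rfl⟩, fun _ _ => rfl⟩ :
    Derivation ℝ A A →+ A) (fun j => S.N j i • S.Y j) Finset.univ
  simp only [AddMonoidHom.coe_mk, ZeroHom.coe_mk] at h
  simp [δ, h]

/-- The matrix `(g_{ij})`. -/
def G : Matrix ι ι A := Matrix.of S.g
/-- The matrix `(g^{ij})`. -/
def H : Matrix ι ι A := Matrix.of S.gi

lemma H_mul_G : S.H * S.G = 1 := by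
  ext i k
  simpa [Matrix.mul_apply, H, G, Matrix.one_apply, g] using S.gi_mul_g i k

lemma G_mul_H : S.G * S.H = 1 := mul_eq_one_comm.1 S.H_mul_G

lemma g_symm (i j : ι) : S.g i j = S.g j i := by rw [g, g, S.Y_Y]

lemma G_transpose : S.Gᵀ = S.G := by
  ext i j; exact S.g_symm j i

lemma H_transpose : S.Hᵀ = S.H := by
  have h : S.Hᵀ * S.G = 1 := by
    rw [← S.G_transpose, ← Matrix.transpose_mul, S.G_mul_H, Matrix.transpose_one]
  calc S.Hᵀ = S.Hᵀ * (S.G * S.H) := by rw [S.G_mul_H, mul_one]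
    _ = S.H := by rw [← mul_assoc, h, one_mul]

lemma gi_symm (i j : ι) : S.gi i j = S.gi j i := congrFun (congrFun S.H_transpose j) i

lemma sum_g_mul_sum_gi (v : ι → A) (i : ι) : ∑ j, S.g i j * ∑ k, S.gi j k * v k = v i := by
  have h : (S.G.mulVec (S.H.mulVec v)) i = v i := by
    rw [Matrix.mulVec_mulVec, S.G_mul_H, Matrix.one_mulVec]
  exact h

lemma sum_gi_mul_sum_g (v : ι → A) (i : ι) : ∑ j, S.gi i j * ∑ k, S.g j k * v k = v i := by
  have h : (S.H.mulVec (S.G.mulVec v)) i = v i := by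
    rw [Matrix.mulVec_mulVec, S.H_mul_G, Matrix.one_mulVec]
  exact h

/-- Vectors that agree after lowering the index agree. -/
lemma eq_of_lower_eq {u v : ι → A} (h : ∀ i, ∑ j, S.g i j * u j = ∑ j, S.g i j * v j) (i : ι) :
    u i = v i := by
  rw [← S.sum_gi_mul_sum_g u, ← S.sum_gi_mul_sum_g v]
  simp only [h]

/-! ### Homogeneity and the Chern connection -/

/-- The Euler derivation `yᵏ ∂/∂yᵏ`. -/
def eu (f : A) : A := ∑ k, S.y k * S.Y k f

lemma eu_mul (a b : A) : S.eu (a * b) = S.eu a * b + a * S.eu b := by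
  simp only [eu, Derivation.leibniz, smul_eq_mul, Finset.sum_mul, Finset.mul_sum,
    ← Finset.sum_add_distrib]
  exact Finset.sum_congr rfl fun k _ => by ring

lemma eu_sum {κ : Type*} [Fintype κ] (f : κ → A) : S.eu (∑ i, f i) = ∑ i, S.eu (f i) := by
  simp only [eu, map_sum, Finset.mul_sum]
  exact Finset.sum_comm

lemma eu_sub (a b : A) : S.eu (a - b) = S.eu a - S.eu b := by
  simp [eu, mul_sub]

lemma eu_half : S.eu (half A) = 0 := by simp [eu]

lemma eu_y (i : ι) : S.eu (S.y i) = S.y i := by simp [eu, S.Y_y]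

/-- Differentiation along the fibre lowers the degree of homogeneity by one. -/
lemma eu_Y (i : ι) (f : A) : S.eu (S.Y i f) = S.Y i (S.eu f) - S.Y i f := by
  simp only [eu, map_sum, Derivation.leibniz, smul_eq_mul, S.Y_y, Finset.sum_add_distrib]
  simp [S.Y_Y i]

lemma eu_X (i : ι) (f : A) : S.eu (S.X i f) = S.X i (S.eu f) := by
  simp [eu, S.X_y, S.X_Y]

lemma eu_Q : S.eu S.Q = 2 * S.Q := S.euler

lemma eu_Y_Q (i : ι) : S.eu (S.Y i S.Q) = S.Y i S.Q := by
  rw [S.eu_Y, S.eu_Q]; simp; ring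

lemma eu_g (i j : ι) : S.eu (S.g i j) = 0 := by
  rw [g, S.eu_mul, S.eu_half, S.eu_Y, S.eu_Y_Q]; simp

lemma eu_s (i : ι) : S.eu (S.s i) = 2 * S.s i := by
  simp only [s, eu_sub, eu_sum, eu_mul, eu_y, eu_X, eu_Y_Q, eu_Q, Finset.sum_add_distrib]
  simp; ring

lemma sum_g_mul_spray (i : ι) : ∑ j, S.g i j * S.spray j = half A * half A * S.s i := by
  have : ∀ j, S.g i j * S.spray j = half A * half A * (S.g i j * ∑ k, S.gi j k * S.s k) :=
    fun j => by rw [spray]; ring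
  simp only [this, ← Finset.mul_sum, S.sum_g_mul_sum_gi]

/-- The spray is homogeneous of degree two: this is read off after lowering its index, since `g` has
degree zero. -/
lemma eu_spray (i : ι) : S.eu (S.spray i) = 2 * S.spray i := by
  refine S.eq_of_lower_eq (u := fun i => S.eu (S.spray i)) (v := fun i => 2 * S.spray i)
    (fun i => ?_) i
  have h := congrArg S.eu (S.sum_g_mul_spray i)
  simp only [eu_sum, eu_mul, eu_g, eu_half, eu_s, zero_mul, zero_add, mul_zero, add_zero] at h
  rw [h]
  have : ∀ j, S.g i j * (2 * S.spray j) = 2 * (S.g i j * S.spray j) := fun j => by ring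
  simp only [this, ← Finset.mul_sum, S.sum_g_mul_spray]; ring

lemma eu_N (i j : ι) : S.eu (S.N i j) = S.N i j := by
  rw [N, S.eu_Y, S.eu_spray]; simp; ring

lemma eu_Y_N (i j k : ι) : S.eu (S.Y k (S.N i j)) = 0 := by
  rw [S.eu_Y, S.eu_N, sub_self]

lemma Y_N_symm (i j k : ι) : S.Y k (S.N i j) = S.Y j (S.N i k) := by rw [N, N, S.Y_Y]

lemma sum_y_mul_g (i : ι) : ∑ k, S.g i k * S.y k = half A * S.Y i S.Q := by
  have h := S.eu_Y_Q i
  rw [← h, eu, Finset.mul_sum]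
  exact Finset.sum_congr rfl fun k _ => by rw [g, S.Y_Y i k]; ring

/-- Contracting the lowered spray with `y` gives `2 Gʲ Q_{yʲ} = yᵏ Q_{xᵏ}`. -/
lemma two_mul_sum_spray_mul_Y_Q :
    2 * ∑ j, S.spray j * S.Y j S.Q = ∑ k, S.y k * S.X k S.Q := by
  have h1 : ∑ j, S.spray j * S.Y j S.Q = half A * ∑ i, S.y i * S.s i := by
    have h2 : ∀ j, S.spray j * S.Y j S.Q = 2 * ∑ k, S.y k * (S.g k j * S.spray j) := fun j => by
      have := S.sum_y_mul_g j
      have h3 : ∑ k, S.y k * (S.g k j * S.spray j) = S.spray j * ∑ k, S.g j k * S.y k := by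
        rw [Finset.mul_sum]
        exact Finset.sum_congr rfl fun k _ => by rw [S.g_symm j k]; ring
      rw [h3, this]
      linear_combination - S.spray j * S.Y j S.Q * two_mul_half (A := A)
    simp only [h2, ← Finset.mul_sum]
    rw [Finset.sum_comm]
    simp only [← Finset.mul_sum, S.sum_g_mul_spray]
    have : ∀ i, S.y i * (half A * half A * S.s i) = half A * half A * (S.y i * S.s i) :=
      fun i => by ring
    simp only [this, ← Finset.mul_sum]
    linear_combination (half A * ∑ i, S.y i * S.s i) * two_mul_half (A := A)
  have h4 : ∑ i, S.y i * S.s i = ∑ k, S.y k * S.X k S.Q := by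
    have h5 : ∀ k, ∑ i, S.y i * (S.X k (S.Y i S.Q) * S.y k) = 2 * (S.y k * S.X k S.Q) :=
      fun k => by
      have : S.eu (S.X k S.Q) = 2 * S.X k S.Q := by rw [S.eu_X, S.eu_Q]; simp
      rw [show 2 * (S.y k * S.X k S.Q) = S.y k * (2 * S.X k S.Q) by ring, ← this, eu,
        Finset.mul_sum]
      exact Finset.sum_congr rfl fun i _ => by rw [S.X_Y]; ring
    simp only [s, mul_sub, Finset.sum_sub_distrib, Finset.mul_sum]
    rw [Finset.sum_comm]
    simp only [h5, ← Finset.mul_sum]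
    ring
  rw [h1, h4, ← mul_assoc, two_mul_half, one_mul]

/-- `F²` is horizontally constant. This is the `yᵐ`-derivative of `2 Gʲ Q_{yʲ} = yᵏ Q_{xᵏ}`,
combined with the definition of the spray. -/
lemma δ_Q (m : ι) : S.δ m S.Q = 0 := by
  have h := congrArg (S.Y m) S.two_mul_sum_spray_mul_Y_Q
  simp only [Derivation.leibniz, map_sum, smul_eq_mul, Finset.sum_add_distrib, S.Y_y] at h
  have h1 : ∑ j, S.spray j * S.Y m (S.Y j S.Q) = half A * S.s m := by
    have h2 : ∀ j, S.spray j * S.Y m (S.Y j S.Q) = 2 * (S.g m j * S.spray j) := fun j => by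
      rw [g]; linear_combination (-(S.spray j * S.Y m (S.Y j S.Q))) * two_mul_half (A := A)
    simp only [h2, ← Finset.mul_sum, S.sum_g_mul_spray]
    linear_combination (half A * S.s m) * two_mul_half (A := A)
  have h3 : ∑ k, S.y k * S.Y m (S.X k S.Q) = ∑ k, S.X k (S.Y m S.Q) * S.y k :=
    Finset.sum_congr rfl fun k _ => by rw [S.X_Y]; ring
  have h4 : ∑ j, S.Y j S.Q * S.Y m (S.spray j) = ∑ j, S.N j m * S.Y j S.Q :=
    Finset.sum_congr rfl fun k _ => by rw [N]; ring
  simp only [h1, h3, h4, mul_ite, mul_one, mul_zero, Finset.sum_ite_eq, Finset.mem_univ,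
    if_true] at h
  rw [derivation_two, s] at h
  rw [δ_apply]
  apply eq_of_two_mul_eq
  linear_combination - h + (∑ k, S.X k (S.Y m S.Q) * S.y k - S.X m S.Q) * two_mul_half (A := A)

/-- The commutator of a vertical and a horizontal derivative is vertical, with coefficients `∂N/∂y`.
-/
lemma δ_Y (k l : ι) (f : A) :
    S.δ k (S.Y l f) = S.Y l (S.δ k f) + ∑ j, S.Y l (S.N j k) * S.Y j f := by
  simp only [δ_apply, map_sub, map_sum, Derivation.leibniz, smul_eq_mul, S.X_Y,
    Finset.sum_add_distrib, S.Y_Y l]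
  have : ∑ j, S.Y j f * S.Y l (S.N j k) = ∑ j, S.Y l (S.N j k) * S.Y j f :=
    Finset.sum_congr rfl fun _ _ => mul_comm _ _
  rw [this]; ring

lemma δ_y (k i : ι) : S.δ k (S.y i) = - S.N i k := by
  simp [δ_apply, S.X_y, S.Y_y]

/-- The second vertical derivative of `δ_k Q = 0`. -/
lemma δ_g (k i l : ι) : S.δ k (S.g i l) =
    half A * (∑ j, S.Y i (S.Y l (S.N j k)) * S.Y j S.Q)
      + (∑ j, S.g i j * S.Y l (S.N j k)) + ∑ j, S.g l j * S.Y i (S.N j k) := by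
  rw [g, Derivation.leibniz, derivation_half, S.δ_Y, S.δ_Y, S.δ_Q]
  simp only [map_sum, map_zero, zero_add, Derivation.leibniz, smul_eq_mul, mul_zero, add_zero,
    Finset.sum_add_distrib, mul_add, Finset.mul_sum, g]
  have h1 : ∀ j, half A * S.Y l (S.Y j S.Q) * S.Y i (S.N j k)
      = half A * (S.Y i (S.N j k) * S.Y j (S.Y l S.Q)) := fun j => by rw [S.Y_Y l j]; ring
  have h2 : ∀ j, half A * S.Y i (S.Y j S.Q) * S.Y l (S.N j k)
      = half A * (S.Y l (S.N j k) * S.Y i (S.Y j S.Q)) := fun j => by ring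
  have h3 : ∀ j, half A * (S.Y j S.Q * S.Y i (S.Y l (S.N j k)))
      = half A * (S.Y i (S.Y l (S.N j k)) * S.Y j S.Q) := fun j => by ring
  simp only [h1, h2, h3]
  ring

/-- The Koszul formula: the Chern coefficients with the upper index lowered. -/
lemma sum_g_mul_Γ (i j k : ι) : ∑ h, S.g i h * S.Γ h j k =
    half A * (S.δ k (S.g j i) + S.δ j (S.g i k) - S.δ i (S.g j k)) := by
  have : ∀ h, S.g i h * S.Γ h j k = half A * (S.g i h * ∑ l, S.gi h l *
      (S.δ k (S.g j l) + S.δ j (S.g l k) - S.δ l (S.g j k))) := fun h => by rw [Γ]; ring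
  simp only [this, ← Finset.mul_sum, S.sum_g_mul_sum_gi]

/-- `Γ` differs from `∂N/∂y` only by a term in the third vertical derivatives of the spray, which is
totally symmetric and vanishes on contraction with `y`. -/
lemma sum_g_mul_Γ_eq (i j k : ι) : ∑ h, S.g i h * S.Γ h j k =
    (∑ h, S.g i h * S.Y j (S.N h k))
      + half A * half A * ∑ h, S.Y i (S.Y j (S.N h k)) * S.Y h S.Q := by
  rw [sum_g_mul_Γ, δ_g, δ_g, δ_g]
  have h3 : ∀ h, S.Y j (S.Y k (S.N h i)) = S.Y i (S.Y j (S.N h k)) := fun h => by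
    rw [S.Y_N_symm h i k, S.Y_Y]
  simp only [h3, S.Y_N_symm _ k i, S.Y_N_symm _ j i, S.Y_N_symm _ j k]
  linear_combination (∑ h, S.g i h * S.Y j (S.N h k)) * two_mul_half (A := A)

lemma Γ_symm (i j k : ι) : S.Γ i j k = S.Γ i k j := by
  simp only [Γ]
  congr 1
  refine Finset.sum_congr rfl fun l _ => ?_
  rw [S.g_symm j l, S.g_symm l k, S.g_symm j k]; ring

/-- The Chern connection induces the nonlinear connection: `Γⁱ_{jk} yʲ = Nⁱ_k`. Equivalently, `y` is
horizontally parallel. -/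
lemma sum_Γ_mul_y (i k : ι) : ∑ j, S.Γ i j k * S.y j = S.N i k := by
  refine S.eq_of_lower_eq (u := fun i => ∑ j, S.Γ i j k * S.y j) (v := fun i => S.N i k)
    (fun i => ?_) i
  have h1 : ∑ h, S.g i h * ∑ j, S.Γ h j k * S.y j = ∑ j, S.y j * ∑ h, S.g i h * S.Γ h j k := by
    simp only [Finset.mul_sum]
    rw [Finset.sum_comm]
    exact Finset.sum_congr rfl fun _ _ => Finset.sum_congr rfl fun _ _ => by ring
  rw [h1]
  simp only [sum_g_mul_Γ_eq, mul_add, Finset.sum_add_distrib]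
  have h2 : ∑ j, S.y j * ∑ h, S.g i h * S.Y j (S.N h k) = ∑ h, S.g i h * S.eu (S.N h k) := by
    simp only [eu, Finset.mul_sum]
    rw [Finset.sum_comm]
    exact Finset.sum_congr rfl fun _ _ => Finset.sum_congr rfl fun _ _ => by ring
  have h3 : ∑ j, S.y j * (half A * half A * ∑ h, S.Y i (S.Y j (S.N h k)) * S.Y h S.Q) =
      half A * half A * ∑ h, S.eu (S.Y i (S.N h k)) * S.Y h S.Q := by
    simp only [eu, Finset.mul_sum, Finset.sum_mul]
    rw [Finset.sum_comm]
    exact Finset.sum_congr rfl fun _ _ => Finset.sum_congr rfl fun _ _ => by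
      rw [S.Y_Y i]; ring
  rw [h2, h3]
  simp [eu_N, eu_Y_N]

/-! ### Curvature and the Bianchi identities -/

/-- The flag curvature is the curvature of the nonlinear connection. -/
lemma flag_eq (i k l : ι) : S.flag i k l = S.δ k (S.N i l) - S.δ l (S.N i k) := by
  have h : ∀ k l, S.δ k (S.N i l) =
      ∑ j, S.y j * (S.δ k (S.Γ i j l) - ∑ m, S.Γ i l m * S.Γ m j k) := fun k l => by
    rw [← S.sum_Γ_mul_y i l]
    simp only [map_sum, Derivation.leibniz, smul_eq_mul, δ_y, ← S.sum_Γ_mul_y _ k, mul_sub,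
      Finset.sum_sub_distrib, Finset.sum_add_distrib, mul_neg, Finset.sum_neg_distrib,
      Finset.mul_sum]
    rw [Finset.sum_comm, neg_add_eq_sub]
    congr 1
    exact Finset.sum_congr rfl fun j _ => Finset.sum_congr rfl fun m _ => by
      rw [S.Γ_symm i m l]; ring
  rw [h, h, flag, ← Finset.sum_sub_distrib]
  exact Finset.sum_congr rfl fun j _ => by rw [riem]; ring

/-- The commutator of horizontal derivatives: `[δ_k, δ_l] = -Rˢ_{kl} ∂/∂yˢ`. -/
lemma δ_δ (k l : ι) (f : A) :
    S.δ k (S.δ l f) = S.δ l (S.δ k f) - ∑ s, S.flag s k l * S.Y s f := by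
  have h : ∀ k l, S.δ k (S.δ l f) = S.X k (S.X l f) - (∑ t, S.N t k * S.X l (S.Y t f))
      - (∑ s, S.δ k (S.N s l) * S.Y s f) - (∑ s, S.N s l * S.X k (S.Y s f))
      + ∑ s, ∑ t, S.N s l * S.N t k * S.Y t (S.Y s f) := fun k l => by
    rw [S.δ_apply l f, map_sub, S.δ_apply k (S.X l f), map_sum]
    simp only [Derivation.leibniz, smul_eq_mul, Finset.sum_add_distrib, S.δ_apply k (S.Y _ f),
      mul_sub, Finset.sum_sub_distrib, Finset.mul_sum, S.X_Y, mul_assoc]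
    have : ∑ s, S.Y s f * S.δ k (S.N s l) = ∑ s, S.δ k (S.N s l) * S.Y s f :=
      Finset.sum_congr rfl fun _ _ => mul_comm _ _
    rw [this]; ring
  have h1 : ∑ s, ∑ t, S.N s l * S.N t k * S.Y t (S.Y s f)
      = ∑ s, ∑ t, S.N s k * S.N t l * S.Y t (S.Y s f) := by
    rw [Finset.sum_comm]
    exact Finset.sum_congr rfl fun j _ => Finset.sum_congr rfl fun m _ => by
      rw [S.Y_Y]; ring
  rw [h k l, h l k, h1, S.X_X k l]
  simp only [flag_eq, sub_mul, Finset.sum_sub_distrib]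
  ring

lemma flag_antisymm (i k l : ι) : S.flag i k l = - S.flag i l k := by
  rw [flag_eq, flag_eq]; ring

lemma riem_antisymm (j i k l : ι) : S.riem j i k l = - S.riem j i l k := by
  rw [riem, riem]; ring

/-- The first Bianchi identity. -/
lemma riem_cyclic (j i k l : ι) : S.riem j i k l + S.riem k i l j + S.riem l i j k = 0 := by
  rw [riem, riem, riem]
  simp only [S.Γ_symm i l j, S.Γ_symm _ k j, S.Γ_symm _ l j, S.Γ_symm _ l k]
  ring

/-- The connection matrix `Γ_k = (Γⁱ_{jk})_{ij}`. -/
def Gam (k : ι) : Matrix ι ι A := Matrix.of fun i j => S.Γ i j k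

/-- The curvature matrix `R_{kl} = (R_j{}^i{}_{kl})_{ij}`. -/
def Rmat (k l : ι) : Matrix ι ι A := Matrix.of fun i j => S.riem j i k l

omit [Fintype ι] [DecidableEq ι] in
lemma map_derivation_add (D : Derivation ℝ A A) (M N : Matrix ι ι A) :
    (M + N).map D = M.map D + N.map D := by ext; simp

omit [Fintype ι] [DecidableEq ι] in
lemma map_derivation_sub (D : Derivation ℝ A A) (M N : Matrix ι ι A) :
    (M - N).map D = M.map D - N.map D := by ext; simp

lemma Rmat_eq (k l : ι) : S.Rmat k l = (S.Gam l).map (S.δ k) - (S.Gam k).map (S.δ l)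
    + S.Gam k * S.Gam l - S.Gam l * S.Gam k := by
  ext i j
  simp only [Rmat, Gam, Matrix.of_apply, Matrix.sub_apply, Matrix.add_apply, Matrix.map_apply,
    Matrix.mul_apply, riem, S.Γ_symm i _ l, S.Γ_symm i _ k]

lemma map_δ_δ (k l : ι) (M : Matrix ι ι A) :
    (M.map (S.δ l)).map (S.δ k) =
      (M.map (S.δ k)).map (S.δ l) - ∑ s, S.flag s k l • M.map (S.Y s) := by
  ext i j
  simp [Matrix.sum_apply, S.δ_δ k l]

/-- The Chern connection is horizontally metric: `g_{ij|k} = 0`. -/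
lemma G_map_δ (k : ι) : S.G.map (S.δ k) = (S.Gam k)ᵀ * S.G + S.G * S.Gam k := by
  ext i j
  have h : ∑ h, S.Γ h i k * S.g h j = ∑ h, S.g j h * S.Γ h i k :=
    Finset.sum_congr rfl fun h _ => by rw [S.g_symm h j, mul_comm]
  simp only [G, Gam, Matrix.map_apply, Matrix.add_apply, Matrix.mul_apply, Matrix.of_apply,
    Matrix.transpose_apply]
  rw [h, sum_g_mul_Γ, sum_g_mul_Γ, S.g_symm j i]
  linear_combination - S.δ k (S.g i j) * two_mul_half (A := A)

lemma H_map_δ (k : ι) : S.H.map (S.δ k) = - (S.H * (S.Gam k)ᵀ + S.Gam k * S.H) := by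
  have h := congrArg (fun M => M.map (S.δ k)) S.H_mul_G
  have h1 : (1 : Matrix ι ι A).map (S.δ k) = 0 := by
    ext i j; by_cases hij : i = j <;> simp [hij]
  simp only [map_derivation_mul, G_map_δ, h1] at h
  have h2 : S.H.map (S.δ k) * S.G * S.H = - (S.H * ((S.Gam k)ᵀ * S.G + S.G * S.Gam k)) * S.H := by
    rw [eq_neg_of_add_eq_zero_left h]
  have h3 : S.H * ((S.Gam k)ᵀ * S.G + S.G * S.Gam k) * S.H
      = S.H * (S.Gam k)ᵀ * (S.G * S.H) + (S.H * S.G) * S.Gam k * S.H := by noncomm_ring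
  rw [mul_assoc, S.G_mul_H, mul_one, neg_mul, h3, S.G_mul_H, S.H_mul_G] at h2
  rw [h2]; simp

lemma δ_gi (k i j : ι) : S.δ k (S.gi i j) =
    -((∑ l, S.Γ i l k * S.gi l j) + ∑ l, S.Γ j l k * S.gi i l) := by
  have h := congrFun (congrFun (S.H_map_δ k) i) j
  simp only [H, Gam, Matrix.map_apply, Matrix.add_apply, Matrix.mul_apply, Matrix.of_apply,
    Matrix.transpose_apply, Matrix.neg_apply] at h
  rw [h, add_comm]
  simp only [mul_comm]

lemma Y_g (s i j : ι) : S.Y s (S.g i j) = 2 * S.C i j s := by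
  rw [g, C, Derivation.leibniz, derivation_half, S.Y_Y s i, S.Y_Y s j]
  simp only [smul_eq_mul]
  linear_combination -(half A * S.Y i (S.Y j (S.Y s S.Q))) * two_mul_half (A := A)

lemma C_symm (i j k : ι) : S.C i j k = S.C j i k := by rw [C, C, S.Y_Y i]

/-- The curvature with the upper index lowered, `R_{jikl} = g_{ih} R_j{}^h{}_{kl}`. -/
def Rm (j i k l : ι) : A := ∑ h, S.g i h * S.riem j h k l

lemma Rm_eq (j i k l : ι) : S.Rm j i k l = (S.G * S.Rmat k l) i j := by
  simp [Rm, G, Rmat, Matrix.mul_apply]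

/-- The tensor `C_{ijs} Rˢ_{kl}`. -/
def CR (i j k l : ι) : A := ∑ s, S.C i j s * S.flag s k l

/-- The failure of `R_{ijkl}` to be skew in its first pair. It comes from applying `[δ_k, δ_l]` to
the metric, whose vertical derivative is the Cartan tensor. -/
lemma Rm_skew (i j k l : ι) : S.Rm i j k l + S.Rm j i k l = - (2 * S.CR i j k l) := by
  have h : ∀ k l, (S.G.map (S.δ l)).map (S.δ k) = ((S.Gam l).map (S.δ k))ᵀ * S.G
      + (S.Gam l)ᵀ * ((S.Gam k)ᵀ * S.G + S.G * S.Gam k)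
      + (((S.Gam k)ᵀ * S.G + S.G * S.Gam k) * S.Gam l + S.G * (S.Gam l).map (S.δ k)) :=
    fun k l => by
    rw [G_map_δ, map_derivation_add, map_derivation_mul, map_derivation_mul, G_map_δ]
    rfl
  have h1 := S.map_δ_δ k l S.G
  rw [h k l, h l k] at h1
  have h2 : (S.G * S.Rmat k l)ᵀ + S.G * S.Rmat k l = - ∑ s, S.flag s k l • S.G.map (S.Y s) := by
    rw [Matrix.transpose_mul, S.G_transpose, Rmat_eq]
    simp only [Matrix.transpose_add, Matrix.transpose_sub, Matrix.transpose_mul]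
    rw [← sub_eq_zero] at h1 ⊢
    rw [← h1]
    noncomm_ring
  have h3 := congrFun (congrFun h2 i) j
  simp only [Matrix.add_apply, Matrix.transpose_apply, ← Rm_eq, Matrix.neg_apply,
    Matrix.sum_apply, Matrix.smul_apply, Matrix.map_apply, smul_eq_mul] at h3
  rw [add_comm, CR, add_comm, h3, Finset.mul_sum]
  congr 1
  exact Finset.sum_congr rfl fun s _ => by
    rw [show S.G i j = S.g i j from rfl, Y_g]; ring

lemma Rm_antisymm (j i k l : ι) : S.Rm j i k l = - S.Rm j i l k := by
  rw [Rm, Rm, ← Finset.sum_neg_distrib]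
  exact Finset.sum_congr rfl fun s _ => by rw [S.riem_antisymm]; ring

lemma Rm_cyclic (j i k l : ι) : S.Rm j i k l + S.Rm k i l j + S.Rm l i j k = 0 := by
  simp only [Rm, ← Finset.sum_add_distrib, ← mul_add, riem_cyclic, mul_zero,
    Finset.sum_const_zero]

/-- The second Bianchi identity, which is the Jacobi identity for the operators `δ_k + Γ_k`.
Horizontal derivatives commute only up to vertical ones, whence the terms with `∂Γ/∂y`. -/
lemma Rmat_bianchi (k l m : ι) :
    ((S.Rmat k l).map (S.δ m) + S.Gam m * S.Rmat k l - S.Rmat k l * S.Gam m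
      + ∑ s, S.flag s k l • (S.Gam m).map (S.Y s))
    + ((S.Rmat l m).map (S.δ k) + S.Gam k * S.Rmat l m - S.Rmat l m * S.Gam k
      + ∑ s, S.flag s l m • (S.Gam k).map (S.Y s))
    + ((S.Rmat m k).map (S.δ l) + S.Gam l * S.Rmat m k - S.Rmat m k * S.Gam l
      + ∑ s, S.flag s m k • (S.Gam l).map (S.Y s)) = 0 := by
  simp only [Rmat_eq, map_derivation_add, map_derivation_sub, map_derivation_mul]
  rw [S.map_δ_δ m k (S.Gam l), S.map_δ_δ k l (S.Gam m), S.map_δ_δ l m (S.Gam k)]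
  noncomm_ring

/-- The horizontal covariant derivative of a covector, `T_{i|k}`. -/
def cov1 (T : ι → A) (i k : ι) : A := S.δ k (T i) - ∑ l, S.Γ l i k * T l

/-- The horizontal covariant derivative `T_{ij|k}`. -/
def cov2 (T : ι → ι → A) (i j k : ι) : A :=
  S.δ k (T i j) - (∑ l, S.Γ l i k * T l j) - ∑ l, S.Γ l j k * T i l

/-- The horizontal covariant derivative `T_{ijp|k}`. -/
def cov3 (T : ι → ι → ι → A) (i j p k : ι) : A :=
  S.δ k (T i j p) - (∑ l, S.Γ l i k * T l j p) - (∑ l, S.Γ l j k * T i l p)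
    - ∑ l, S.Γ l p k * T i j l

/-- The horizontal covariant derivative `T_{ijpq|k}`. -/
def cov4 (T : ι → ι → ι → ι → A) (i j p q k : ι) : A :=
  S.δ k (T i j p q) - (∑ l, S.Γ l i k * T l j p q) - (∑ l, S.Γ l j k * T i l p q)
    - (∑ l, S.Γ l p k * T i j l q) - ∑ l, S.Γ l q k * T i j p l

/-- The tensor `g_{ih} (∂Γʰ_{jm}/∂yˢ) Rˢ_{kl}` occurring in the second Bianchi identity. -/
def BR (i j m k l : ι) : A := ∑ s, (∑ h, S.g i h * S.Y s (S.Γ h j m)) * S.flag s k l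

lemma cov4_Rm_add_BR (j i k l m : ι) : S.cov4 S.Rm j i k l m + S.BR i j m k l =
    (S.G * ((S.Rmat k l).map (S.δ m) + S.Gam m * S.Rmat k l - S.Rmat k l * S.Gam m
      + ∑ s, S.flag s k l • (S.Gam m).map (S.Y s))) i j
      - (∑ s, S.Γ s k m * S.Rm j i s l) - ∑ s, S.Γ s l m * S.Rm j i k s := by
  have h1 : S.G * ((S.Rmat k l).map (S.δ m) + S.Gam m * S.Rmat k l - S.Rmat k l * S.Gam m
      + ∑ s, S.flag s k l • (S.Gam m).map (S.Y s)) =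
      (S.G * S.Rmat k l).map (S.δ m) - (S.Gam m)ᵀ * (S.G * S.Rmat k l)
        - S.G * S.Rmat k l * S.Gam m
        + ∑ s, S.flag s k l • (S.G * (S.Gam m).map (S.Y s)) := by
    rw [map_derivation_mul, G_map_δ, mul_add, Finset.mul_sum]
    simp only [Matrix.mul_smul]
    noncomm_ring
  rw [h1]
  have h2 : ∑ s, S.flag s k l * (S.G * (S.Gam m).map (S.Y s)) i j = S.BR i j m k l :=
    Finset.sum_congr rfl fun s _ => by
      simp only [Matrix.mul_apply, G, Gam, Matrix.map_apply, Matrix.of_apply]; rw [mul_comm]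
  simp only [Matrix.add_apply, Matrix.sub_apply, Matrix.sum_apply, Matrix.smul_apply, smul_eq_mul,
    h2, Matrix.map_apply, ← Rm_eq]
  rw [Matrix.mul_apply, Matrix.mul_apply]
  simp only [← Rm_eq, Gam, Matrix.transpose_apply, Matrix.of_apply, cov4]
  have h3 : ∑ x, S.Rm x i k l * S.Γ x j m = ∑ x, S.Γ x j m * S.Rm x i k l :=
    Finset.sum_congr rfl fun _ _ => mul_comm _ _
  rw [h3]; ring

/-- The second Bianchi identity with lowered indices. -/
lemma Rm_bianchi (j i k l m : ι) :
    (S.cov4 S.Rm j i k l m + S.BR i j m k l) + (S.cov4 S.Rm j i l m k + S.BR i j k l m)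
      + (S.cov4 S.Rm j i m k l + S.BR i j l m k) = 0 := by
  have h := congrFun (congrFun (congrArg (fun M : Matrix ι ι A => S.G * M)
    (S.Rmat_bianchi k l m)) i) j
  -- The connection terms acting on the last two indices cancel in the cyclic sum.
  have h1 : ∀ k l m, ∑ s, S.Γ s k m * S.Rm j i s l = - ∑ s, S.Γ s m k * S.Rm j i l s :=
    fun k l m => by
    rw [← Finset.sum_neg_distrib]
    exact Finset.sum_congr rfl fun s _ => by rw [S.Γ_symm s k m, S.Rm_antisymm j i s l]; ring
  rw [cov4_Rm_add_BR, cov4_Rm_add_BR, cov4_Rm_add_BR, h1 k l m, h1 l m k, h1 m k l]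
  simp only [mul_add, Matrix.add_apply, mul_zero, Matrix.zero_apply] at h ⊢
  linear_combination h

/-! ### Contraction -/

/-- Contraction with the inverse metric, `g^{ij} f_{ij}`. -/
def tr (f : ι → ι → A) : A := ∑ i, ∑ j, S.gi i j * f i j

lemma tr_add (f h : ι → ι → A) : S.tr (fun i j => f i j + h i j) = S.tr f + S.tr h := by
  simp only [tr, mul_add, Finset.sum_add_distrib]

lemma tr_sub (f h : ι → ι → A) : S.tr (fun i j => f i j - h i j) = S.tr f - S.tr h := by
  simp only [tr, mul_sub, Finset.sum_sub_distrib]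

lemma tr_neg (f : ι → ι → A) : S.tr (fun i j => - f i j) = - S.tr f := by
  simp only [tr, mul_neg, Finset.sum_neg_distrib]

lemma tr_mul_left (a : A) (f : ι → ι → A) : S.tr (fun i j => a * f i j) = a * S.tr f := by
  simp only [tr, Finset.mul_sum]
  exact Finset.sum_congr rfl fun _ _ => Finset.sum_congr rfl fun _ _ => by ring

lemma tr_mul_right (a : A) (f : ι → ι → A) : S.tr (fun i j => f i j * a) = S.tr f * a := by
  simp only [mul_comm _ a, tr_mul_left]

lemma tr_sum {κ : Type*} [Fintype κ] (f : κ → ι → ι → A) :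
    S.tr (fun i j => ∑ l, f l i j) = ∑ l, S.tr (f l) := by
  simp only [tr, Finset.mul_sum]
  symm
  rw [Finset.sum_comm]
  exact Finset.sum_congr rfl fun _ _ => Finset.sum_comm

lemma tr_swap (f : ι → ι → A) : S.tr (fun i j => f j i) = S.tr f := by
  simp only [tr]
  rw [Finset.sum_comm]
  simp only [S.gi_symm]

lemma tr_comm (f : ι → ι → ι → ι → A) :
    S.tr (fun i j => S.tr fun k l => f i j k l) = S.tr (fun k l => S.tr fun i j => f i j k l) := by
  rw [tr]
  simp only [← tr_mul_left, ← tr_sum]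
  rfl

/-- Since the connection is metric, contraction commutes with covariant differentiation. -/
lemma δ_tr (m : ι) (f : ι → ι → A) : S.δ m (S.tr f) = S.tr fun i j => S.cov2 f i j m := by
  have h2 : ∀ f : ι → ι → A, ∑ i, ∑ j, (∑ l, S.Γ j l m * S.gi i l) * f i j
      = S.tr fun i j => ∑ l, S.Γ l j m * f i l := fun f => by
    simp only [tr, Finset.sum_mul, Finset.mul_sum]
    refine Finset.sum_congr rfl fun i _ => ?_
    rw [Finset.sum_comm]
    exact Finset.sum_congr rfl fun _ _ => Finset.sum_congr rfl fun _ _ => by ring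
  have h1 : ∑ i, ∑ j, (∑ l, S.Γ i l m * S.gi l j) * f i j
      = S.tr fun i j => ∑ l, S.Γ l i m * f l j := by
    rw [← S.tr_swap, ← h2 fun i j => f j i, Finset.sum_comm]
    simp only [S.gi_symm]
  simp only [cov2, tr_sub, ← h1, ← h2]
  simp only [tr, map_sum, Derivation.leibniz, smul_eq_mul, δ_gi,
    Finset.sum_add_distrib, mul_comm (f _ _)]
  simp only [neg_mul, add_mul, Finset.sum_neg_distrib, Finset.sum_add_distrib]
  ring

lemma cov1_tr (T : ι → ι → ι → A) (i m : ι) :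
    S.cov1 (fun a => S.tr fun k l => T k l a) i m = S.tr fun k l => S.cov3 T k l i m := by
  simp only [cov1, δ_tr, cov3, cov2, tr_sub, tr_sum, tr_mul_left]

lemma cov2_tr (T : ι → ι → ι → ι → A) (i j m : ι) :
    S.cov2 (fun a b => S.tr fun k l => T k l a b) i j m = S.tr fun k l => S.cov4 T k l i j m := by
  simp only [cov2, δ_tr, cov4, tr_sub, tr_sum, tr_mul_left]

/-! ### The vertical derivative of the connection -/

/-- The tensor `C_{ijs|m} - C_{ijt} Lᵗ_{ms}`. -/
def W (i j s m : ι) : A := S.cov3 S.C i j s m - ∑ t, S.C i j t * S.landsberg t m s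

/-- The vertical derivative of `g_{ij|m} = 0`. -/
lemma sum_g_mul_Y_Γ_add_swap (i j m s : ι) :
    (∑ h, S.g i h * S.Y s (S.Γ h j m)) + (∑ h, S.g j h * S.Y s (S.Γ h i m)) = 2 * S.W i j s m := by
  have h1 : S.δ m (S.g i j) = (∑ h, S.g i h * S.Γ h j m) + ∑ h, S.g j h * S.Γ h i m := by
    rw [sum_g_mul_Γ, sum_g_mul_Γ, S.g_symm j i]
    linear_combination - S.δ m (S.g i j) * two_mul_half (A := A)
  have h2 := S.δ_Y m s (S.g i j)
  rw [h1] at h2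
  simp only [Y_g, map_add, map_sum, Derivation.leibniz, smul_eq_mul, derivation_two, mul_zero,
    add_zero, Finset.sum_add_distrib] at h2
  have h3 : ∀ i j, ∑ h, S.Γ h j m * (2 * S.C i h s) = 2 * ∑ h, S.Γ h j m * S.C i h s :=
    fun i j => by
    rw [Finset.mul_sum]; exact Finset.sum_congr rfl fun _ _ => by ring
  -- The Landsberg tensor is the difference between `∂N/∂y` and `Γ`.
  have h4 : ∑ t, S.Y s (S.N t m) * (2 * S.C i j t)
      = 2 * ((∑ t, S.C i j t * S.landsberg t m s) + ∑ t, S.Γ t s m * S.C i j t) := by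
    rw [← Finset.sum_add_distrib, Finset.mul_sum]
    exact Finset.sum_congr rfl fun t _ => by
      rw [landsberg, N, S.Y_Y s, S.Γ_symm t s]; ring
  rw [h3, h3, h4] at h2
  rw [W, cov3]
  have h5 : ∑ l, S.Γ l i m * S.C l j s = ∑ l, S.Γ l i m * S.C j l s :=
    Finset.sum_congr rfl fun l _ => by rw [S.C_symm l j]
  rw [h5]
  linear_combination - h2

lemma W_symm (i j s m : ι) : S.W i j s m = S.W j i s m := by
  apply eq_of_two_mul_eq
  rw [← sum_g_mul_Y_Γ_add_swap, ← sum_g_mul_Y_Γ_add_swap]; ring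

/-- The vertical derivative of `Γ`. Being symmetric in two of its indices, it is determined by
`sum_g_mul_Y_Γ_add_swap` through the usual three-term permutation. -/
lemma sum_g_mul_Y_Γ (i j m s : ι) :
    ∑ h, S.g i h * S.Y s (S.Γ h j m) = S.W i j s m + S.W i m s j - S.W j m s i := by
  have h1 := S.sum_g_mul_Y_Γ_add_swap i j m s
  have h2 := S.sum_g_mul_Y_Γ_add_swap i m j s
  have h3 := S.sum_g_mul_Y_Γ_add_swap j m i s
  have e1 : ∀ i j m, ∑ h, S.g i h * S.Y s (S.Γ h j m) = ∑ h, S.g i h * S.Y s (S.Γ h m j) :=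
    fun i j m => by simp only [S.Γ_symm _ j m]
  rw [e1 m i j] at h2
  rw [e1 j i m] at h1
  rw [e1 i m j] at h2
  apply eq_of_two_mul_eq
  linear_combination h1 + h2 - h3

/-- The tensor `(C_{ijs|m} - C_{ijt} Lᵗ_{ms}) Rˢ_{kl}`; the arguments are `i j m k l`. -/
def WR (i j m k l : ι) : A := ∑ s, S.W i j s m * S.flag s k l

lemma BR_eq (i j m k l : ι) :
    S.BR i j m k l = S.WR i j m k l + S.WR i m j k l - S.WR j m i k l := by
  simp only [BR, WR, sum_g_mul_Y_Γ, add_mul, sub_mul, Finset.sum_add_distrib,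
    Finset.sum_sub_distrib]

lemma WR_symm (i j m k l : ι) : S.WR i j m k l = S.WR j i m k l := by
  simp only [WR, S.W_symm i j]

lemma WR_antisymm (i j m k l : ι) : S.WR i j m k l = - S.WR i j m l k := by
  simp only [WR, S.flag_antisymm _ k l, mul_neg, Finset.sum_neg_distrib]

lemma CR_antisymm (i j k l : ι) : S.CR i j k l = - S.CR i j l k := by
  simp only [CR, S.flag_antisymm _ k l, mul_neg, Finset.sum_neg_distrib]

/-! ### Contracted curvature -/

/-- `R̄_{ij} = g^{kl} R_{kijl}`. -/
def Rb (i j : ι) : A := S.tr fun k l => S.Rm k i j l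

/-- The scalar curvature, as the trace of `R̄`. -/
def Sc : A := S.tr S.Rb

/-- The tensor `Cᵗ_{as} Rˢ_{tb}`. -/
def T (a b : ι) : A := S.tr fun t u => S.CR t a u b

/-- The skew part of `R̄`, from the first Bianchi identity and `Rm_skew`. -/
lemma Rb_sub_Rb (i j : ι) :
    S.Rb i j - S.Rb j i = 2 * (S.T i j - S.T j i) - S.tr fun k l => S.CR k l i j := by
  have h : ∀ k l, S.Rm k i j l = S.Rm k j i l + S.Rm l k i j + 2 * S.CR k i l j
      - 2 * S.CR k j l i := fun k l => by
    have h1 := S.Rm_skew k i j l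
    have h2 := S.Rm_skew k j i l
    rw [S.CR_antisymm k i j l] at h1
    rw [S.CR_antisymm k j i l] at h2
    linear_combination h1 - h2 - S.Rm_cyclic i k j l + S.Rm_antisymm j k i l
  have h3 : S.tr (fun k l => S.Rm l k i j) = - S.tr fun k l => S.CR k l i j := by
    apply eq_of_two_mul_eq
    rw [two_mul]
    nth_rw 1 [← S.tr_swap]
    rw [← tr_add]
    simp only [Rm_skew, tr_neg, tr_mul_left]
    ring
  rw [Rb, Rb, T, T]
  simp only [h, tr_add, tr_sub, tr_mul_left, h3]
  ring

/-! ### Derivatives of the distortion -/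

variable (τ : A)

/-- The horizontal differential `τ_{|i}`. -/
def t (i : ι) : A := S.δ i τ

/-- The horizontal Hessian `τ_{|i|j}`. -/
def hess (i j : ι) : A := S.cov1 (S.t τ) i j

/-- The Ricci identity for the second covariant derivatives of a covector. -/
lemma ricci_identity (U : ι → A) (i m j : ι) :
    S.cov2 (S.cov1 U) i m j = S.cov2 (S.cov1 U) i j m - (∑ s, S.flag s j m * S.Y s (U i))
      - ∑ h, S.riem i h j m * U h := by
  have h1 : ∀ m j, S.cov2 (S.cov1 U) i m j = S.δ j (S.δ m (U i))
      - (∑ h, (S.δ j (S.Γ h i m) - ∑ l, S.Γ h m l * S.Γ l i j) * U h)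
      - (∑ l, S.Γ l i m * S.δ j (U l)) - (∑ l, S.Γ l i j * S.δ m (U l))
      - ∑ l, S.Γ l m j * S.cov1 U i l := fun m j => by
    have h2 : ∑ l, S.Γ l i j * S.cov1 U l m = (∑ l, S.Γ l i j * S.δ m (U l))
        - ∑ h, (∑ l, S.Γ h m l * S.Γ l i j) * U h := by
      simp only [cov1, mul_sub, Finset.sum_sub_distrib, Finset.mul_sum, Finset.sum_mul]
      congr 1
      rw [Finset.sum_comm]
      exact Finset.sum_congr rfl fun _ _ => Finset.sum_congr rfl fun l _ => by
        rw [S.Γ_symm _ m l]; ring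
    have h3 : ∑ l, U l * S.δ j (S.Γ l i m) = ∑ l, S.δ j (S.Γ l i m) * U l :=
      Finset.sum_congr rfl fun _ _ => mul_comm _ _
    rw [cov2, h2, cov1, map_sub, map_sum]
    simp only [Derivation.leibniz, smul_eq_mul, Finset.sum_add_distrib, sub_mul,
      Finset.sum_sub_distrib, h3]
    ring
  rw [h1 m j, h1 j m, S.δ_δ j m]
  simp only [riem, add_mul, sub_mul, Finset.sum_add_distrib, Finset.sum_sub_distrib,
    S.Γ_symm _ j m]
  ring

section Distortion

variable {τ : A} (hτ : ∀ s, S.Y s τ = S.tr fun a b => S.C a b s)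
include hτ

/-- The skew part of the Hessian of the distortion. It cancels the trace term in the skew part of
`R̄` (`Rb_sub_Rb`). -/
lemma hess_sub_hess (i j : ι) :
    S.hess τ i j - S.hess τ j i = S.tr fun k l => S.CR k l i j := by
  have h : ∑ s, S.flag s i j * S.Y s τ = S.tr fun k l => S.CR k l i j := by
    simp only [hτ, ← tr_mul_left, ← tr_sum, CR]
    simp only [mul_comm]
  rw [hess, hess, cov1, cov1, t, t, S.δ_δ j i τ]
  simp only [S.flag_antisymm _ j i, S.Γ_symm _ j i, neg_mul, Finset.sum_neg_distrib, h]
  ring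

/-- The vertical derivative of `τ_{|i}`, obtained by commuting it past the horizontal derivative and
using `∂τ/∂yˢ = g^{ab} C_{abs}`. -/
lemma Y_t (s i : ι) : S.Y s (S.t τ i) = S.tr fun a b => S.W a b s i := by
  have h := S.δ_Y i s τ
  have h1 := S.cov1_tr S.C s i
  simp only [W, tr_sub, tr_sum, tr_mul_right, ← h1, ← hτ]
  rw [t, cov1, h]
  have h3 : ∑ j, S.Y s (S.N j i) * S.Y j τ
      = (∑ j, S.Y j τ * S.landsberg j i s) + ∑ j, S.Γ j s i * S.Y j τ := by
    rw [← Finset.sum_add_distrib]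
    exact Finset.sum_congr rfl fun t _ => by
      rw [landsberg, N, S.Y_Y s, S.Γ_symm t s]; ring
  rw [h3]; ring

/-- The Ricci identity for `τ_{|i}`. -/
lemma cov2_hess (i m j : ι) : S.cov2 (S.hess τ) i m j = S.cov2 (S.hess τ) i j m
    - (S.tr fun a b => S.WR a b i j m) - S.tr fun h u => S.t τ h * S.Rm i u j m := by
  have h := S.ricci_identity (S.t τ) i m j
  have h1 : ∑ s, S.flag s j m * S.Y s (S.t τ i) = S.tr fun a b => S.WR a b i j m := by
    simp only [S.Y_t hτ, ← tr_mul_left, ← tr_sum, WR]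
    simp only [mul_comm]
  have h2 : ∑ h, S.riem i h j m * S.t τ h = S.tr fun h u => S.t τ h * S.Rm i u j m := by
    have h3 : ∀ h, S.riem i h j m = ∑ u, S.gi h u * S.Rm i u j m :=
      fun h => (S.sum_gi_mul_sum_g (fun h => S.riem i h j m) h).symm
    simp only [h3, tr, Finset.sum_mul]
    exact Finset.sum_congr rfl fun _ _ => Finset.sum_congr rfl fun l _ => by ring
  rw [h1, h2] at h
  exact h

end Distortion

/-! ### The contracted Bianchi identity and the soliton identity -/

lemma cov2_g (i j m : ι) : S.cov2 S.g i j m = 0 := by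
  have h := congrFun (congrFun (S.G_map_δ m) i) j
  simp only [G, Gam, Matrix.map_apply, Matrix.add_apply, Matrix.mul_apply, Matrix.of_apply,
    Matrix.transpose_apply] at h
  rw [cov2, h]
  simp only [mul_comm (S.g _ _)]
  ring

lemma tr_g_mul (U : ι → A) (m : ι) : S.tr (fun h u => S.g u m * U h) = U m := by
  have h := S.sum_g_mul_sum_gi U m
  rw [← h, tr, Finset.sum_comm]
  simp only [Finset.mul_sum]
  exact Finset.sum_congr rfl fun u _ => Finset.sum_congr rfl fun h _ => by
    rw [S.gi_symm u h, S.g_symm u m]; ring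

lemma tr_zero : S.tr (fun _ _ => 0) = 0 := by simp [tr]

lemma tr_tr_cov4_Rm (m : ι) :
    S.tr (fun i k => S.tr fun j l => S.cov4 S.Rm j i k l m) = S.δ m S.Sc := by
  rw [Sc, δ_tr]
  congr 1; ext i k
  have h := S.cov2_tr (fun j l i k => S.Rm j i k l) i k m
  have h1 : S.cov2 S.Rb i k m = S.cov2 (fun a b => S.tr fun k l => S.Rm k a b l) i k m := rfl
  rw [h1, h]
  congr 1; ext j l
  rw [cov4, cov4]; ring

lemma tr_cov4_Rm (i m k : ι) :
    S.tr (fun j l => S.cov4 S.Rm j i m l k) = S.cov2 S.Rb i m k := by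
  have h := S.cov2_tr (fun j l i k => S.Rm j i k l) i m k
  have h1 : S.cov2 S.Rb i m k = S.cov2 (fun a b => S.tr fun k l => S.Rm k a b l) i m k := rfl
  rw [h1, h]
  congr 1; ext j l
  rw [cov4, cov4]; ring

lemma tr_cov4_CR (j m l : ι) :
    S.tr (fun i k => S.cov4 S.CR i j k m l) = S.cov2 S.T j m l := by
  have h := S.cov2_tr (fun i k j m => S.CR i j k m) j m l
  have h1 : S.cov2 S.T j m l = S.cov2 (fun a b => S.tr fun t u => S.CR t a u b) j m l := rfl
  rw [h1, h]
  congr 1; ext i k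
  rw [cov4, cov4]; ring

/-- The part of the first contracted term that is symmetric in `i, j` drops out. -/
lemma tr_tr_BR_fst (m : ι) : S.tr (fun i k => S.tr fun j l => S.BR i j m k l) =
    2 * S.tr fun i k => S.tr fun j l => S.WR i m j k l := by
  -- Exchanging both `i, j` and `k, l` changes the sign.
  have h1 : S.tr (fun i k => S.tr fun j l => S.WR i j m k l) = 0 := by
    have h : S.tr (fun i k => S.tr fun j l => S.WR i j m k l)
        = - S.tr fun i k => S.tr fun j l => S.WR i j m k l := by
      conv_lhs => rw [S.tr_comm]
      simp only [← tr_neg]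
      congr 1; ext a b
      congr 1; ext c d
      rw [S.WR_symm c a, S.WR_antisymm]
    apply eq_of_two_mul_eq
    linear_combination h
  have h2 : S.tr (fun i k => S.tr fun j l => S.WR j m i k l)
      = - S.tr fun i k => S.tr fun j l => S.WR i m j k l := by
    rw [S.tr_comm]
    simp only [← tr_neg, ← S.WR_antisymm]
  simp only [BR_eq, tr_add, tr_sub, h1, h2]
  ring

lemma tr_tr_BR_snd (m : ι) : S.tr (fun i k => S.tr fun j l => S.BR i j k l m) =
    S.tr fun j l => S.tr fun a b => S.WR a b j l m := by
  rw [S.tr_comm]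
  congr 1; ext j l
  have h : S.tr (fun i k => S.WR j k i l m) = S.tr fun i k => S.WR i j k l m := by
    rw [← S.tr_swap]
    simp only [S.WR_symm j]
  simp only [BR_eq, tr_add, tr_sub, h]
  ring

lemma tr_tr_BR_thd (m : ι) : S.tr (fun i k => S.tr fun j l => S.BR i j l m k) =
    (S.tr fun i k => S.tr fun a b => S.WR a b i k m)
      - 2 * S.tr fun j l => S.tr fun i k => S.WR i j l k m := by
  rw [S.tr_comm fun j l i k => S.WR i j l k m, ← tr_mul_left, ← tr_sub]
  congr 1; ext i k
  have h : S.tr (fun j l => S.WR i l j m k) = S.tr fun j l => S.WR i j l m k := S.tr_swap _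
  have h1 : S.tr (fun j l => S.WR i j l m k) = - S.tr fun j l => S.WR i j l k m := by
    rw [← tr_neg]; simp only [← S.WR_antisymm]
  have h2 : S.tr (fun j l => S.WR j l i m k) = - S.tr fun j l => S.WR j l i k m := by
    rw [← tr_neg]; simp only [← S.WR_antisymm]
  simp only [BR_eq, tr_add, tr_sub, h, h1, h2]
  ring

/-- The twice contracted second Bianchi identity. In Riemannian geometry only the first two terms
are present. -/
lemma contracted_bianchi (m : ι) :
    S.δ m S.Sc - 2 * (S.tr fun i k => S.cov2 S.Rb i m k) + 2 * (S.tr fun j l => S.cov2 S.T j m l)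
      + 2 * (S.tr fun i j => S.tr fun a b => S.WR a b i j m)
      + 2 * (S.tr fun i k => S.tr fun j l => S.WR i m j k l)
      - 2 * (S.tr fun j l => S.tr fun i k => S.WR i j l k m) = 0 := by
  have h : S.tr (fun i k => S.tr fun j l => (S.cov4 S.Rm j i k l m + S.BR i j m k l)
      + (S.cov4 S.Rm j i l m k + S.BR i j k l m)
      + (S.cov4 S.Rm j i m k l + S.BR i j l m k)) = 0 := by
    simp only [Rm_bianchi, tr_zero]
  have e1 : ∀ (F : ι → ι → ι → ι → A) (_ : ∀ i j k l, F i j k l = - F i j l k) (i j k l m : ι),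
      S.cov4 F i j k l m = - S.cov4 F i j l k m := fun F hF i j k l m => by
    rw [cov4, cov4, hF i j k l]
    simp only [hF _ _ k l, hF i j _ l, hF i j k _, mul_neg, Finset.sum_neg_distrib, map_neg]
    ring
  have h1 : S.tr (fun i k => S.tr fun j l => S.cov4 S.Rm j i l m k)
      = - S.tr fun i k => S.cov2 S.Rb i m k := by
    simp only [e1 S.Rm S.Rm_antisymm _ _ _ m, tr_neg, tr_cov4_Rm]
  have e2 : ∀ i j k l m, S.cov4 S.Rm j i k l m
      = - S.cov4 S.Rm i j k l m - 2 * S.cov4 S.CR i j k l m := fun i j k l m => by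
    have e3 : ∀ i j k l, S.Rm j i k l = - S.Rm i j k l - 2 * S.CR i j k l := fun i j k l => by
      linear_combination S.Rm_skew i j k l
    rw [cov4, e3 i j k l]
    simp only [e3 _ j _ _, e3 i _ _ _, cov4, mul_sub, mul_neg, Finset.sum_neg_distrib,
      Finset.sum_sub_distrib, map_neg, map_sub, mul_left_comm _ (2 : A), ← Finset.mul_sum,
      Derivation.leibniz, derivation_two, smul_eq_mul]
    ring
  have h2 : S.tr (fun i k => S.tr fun j l => S.cov4 S.Rm j i m k l)
      = - (S.tr fun i k => S.cov2 S.Rb i m k) + 2 * S.tr fun j l => S.cov2 S.T j m l := by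
    have e4 : ∀ i j k l, S.cov4 S.Rm j i m k l
        = 2 * S.cov4 S.CR i j k m l - S.cov4 S.Rm i j m k l := fun i j k l => by
      rw [e2, e1 S.CR S.CR_antisymm _ _ m]; ring
    rw [S.tr_comm]
    calc _ = S.tr fun j l => S.tr fun i k => 2 * S.cov4 S.CR i j k m l - S.cov4 S.Rm i j m k l := by
          congr 1; ext j l; congr 1; ext i k; exact e4 i j k l
      _ = _ := by
          simp only [tr_sub, tr_mul_left, tr_cov4_Rm, tr_cov4_CR]
          ring
  simp only [tr_add, tr_tr_cov4_Rm, tr_tr_BR_fst, tr_tr_BR_snd, tr_tr_BR_thd, h1, h2] at h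
  linear_combination h

/-- The soliton identity in contracted form. The hypothesis `hτ` is the only property of the
distortion that is used; `hsol` is the symmetric part of the soliton equation. -/
theorem soliton_identity {τ : A} (hτ : ∀ s, S.Y s τ = S.tr fun a b => S.C a b s)
    (hsol : ∀ i j, S.Rb i j + S.hess τ i j + (S.Rb j i + S.hess τ j i) = S.g i j) (m : ι) :
    half A * S.δ m (S.Sc + S.tr (fun i j => S.t τ i * S.t τ j) - τ)
      + S.tr (fun i j => S.t τ j * (S.T m i - S.T i m)) =
    S.tr (fun i j => S.cov2 S.T m i j)
      + S.tr (fun i j => S.tr fun t u => S.WR u m j t i)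
      - S.tr (fun i j => S.tr fun t u => S.WR u i j t m) := by
  -- The symmetric part comes from the soliton equation, the skew part from the Bianchi identity.
  have hRb : ∀ i j, S.Rb i j = half A * S.g i j + S.T i j - S.T j i - S.hess τ i j := fun i j => by
    apply eq_of_two_mul_eq
    linear_combination hsol i j + S.Rb_sub_Rb i j + S.hess_sub_hess hτ i j
      - S.g i j * two_mul_half (A := A)
  have htrT : S.tr (fun i j => S.T j i) = S.tr S.T := S.tr_swap _
  -- The trace of `g` is the dimension, hence horizontally constant.
  have hdg : S.δ m (S.tr S.g) = 0 := by
    rw [δ_tr]; simp only [cov2_g, tr_zero]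
  have hSc : S.δ m S.Sc = - S.tr fun i j => S.cov2 (S.hess τ) i j m := by
    rw [← δ_tr, ← map_neg, Sc, show S.Rb = fun i j => S.Rb i j from rfl]
    simp only [hRb, tr_sub, tr_add, tr_mul_left, htrT]
    simp only [map_sub, map_add, Derivation.leibniz, hdg, derivation_half, map_neg, smul_eq_mul]
    ring
  have hcRb : ∀ i j k, S.cov2 S.Rb i j k =
      S.cov2 S.T i j k - S.cov2 S.T j i k - S.cov2 (S.hess τ) i j k := fun i j k => by
    have hg := S.cov2_g i j k
    rw [cov2] at hg
    simp only [cov2, hRb, mul_sub, mul_add, Finset.sum_sub_distrib, Finset.sum_add_distrib,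
      map_sub, map_add, Derivation.leibniz, derivation_half, smul_eq_mul,
      mul_left_comm _ (half A), ← Finset.mul_sum]
    linear_combination half A * hg
  have hP : S.tr (fun i j => S.tr fun h u => S.t τ h * S.Rm i u j m)
      = - S.tr fun h u => S.Rb u m * S.t τ h := by
    rw [S.tr_comm, ← tr_neg]
    congr 1; ext h u
    have h1 : S.tr (fun i j => S.Rm i u j m) = - S.Rb u m := by
      rw [Rb, ← tr_neg]
      congr 1; ext i j; exact S.Rm_antisymm i u j m
    rw [tr_mul_left, h1]
    ring
  have hnorm : S.δ m (S.tr fun i j => S.t τ i * S.t τ j)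
      = 2 * S.tr fun h u => S.hess τ u m * S.t τ h := by
    have h1 : S.tr (fun h u => S.hess τ h m * S.t τ u) = S.tr fun h u => S.hess τ u m * S.t τ h :=
      S.tr_swap fun h u => S.hess τ u m * S.t τ h
    have h2 : ∀ i j, S.cov2 (fun i j => S.t τ i * S.t τ j) i j m
        = S.hess τ i m * S.t τ j + S.hess τ j m * S.t τ i := fun i j => by
      simp only [cov2, hess, cov1, Derivation.leibniz, smul_eq_mul, sub_mul, Finset.sum_mul]
      have h3 : ∑ l, S.Γ l j m * (S.t τ i * S.t τ l) = ∑ l, S.Γ l j m * S.t τ l * S.t τ i :=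
        Finset.sum_congr rfl fun _ _ => by ring
      have h4 : ∑ l, S.Γ l i m * (S.t τ l * S.t τ j) = ∑ l, S.Γ l i m * S.t τ l * S.t τ j :=
        Finset.sum_congr rfl fun _ _ => by ring
      rw [h3, h4]; ring
    rw [δ_tr]
    simp only [h2, tr_add, h1]
    ring
  have hRbt : S.tr (fun h u => S.Rb u m * S.t τ h) = half A * S.t τ m
      + S.tr (fun h u => (S.T u m - S.T m u) * S.t τ h)
      - S.tr fun h u => S.hess τ u m * S.t τ h := by
    simp only [hRb, sub_mul, add_mul, tr_sub, tr_add, mul_assoc, tr_mul_left, tr_g_mul]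
    ring
  have hflip : S.tr (fun i j => S.t τ j * (S.T m i - S.T i m))
      = - S.tr (fun h u => (S.T u m - S.T m u) * S.t τ h) := by
    rw [← tr_neg, ← S.tr_swap]
    congr 1; ext i j; ring
  have hdiv : S.tr (fun i j => S.cov2 (S.hess τ) i m j) = - S.δ m S.Sc
      - (S.tr fun i j => S.tr fun a b => S.WR a b i j m)
      + S.tr fun h u => S.Rb u m * S.t τ h := by
    rw [show (fun i j => S.cov2 (S.hess τ) i m j) = _ from
      funext₂ fun i j => S.cov2_hess hτ i m j]
    simp only [tr_sub, hP, hSc]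
    ring
  have hK1 : S.tr (fun i k => S.tr fun j l => S.WR i m j k l)
      = S.tr (fun i j => S.tr fun t u => S.WR u m j t i) := by
    rw [S.tr_comm, ← S.tr_swap]
    congr 1; ext i j
    rw [← S.tr_swap]
  have hK2 : S.tr (fun j l => S.tr fun i k => S.WR i j l k m)
      = S.tr (fun i j => S.tr fun t u => S.WR u i j t m) := by
    congr 1; ext i j
    rw [← S.tr_swap]
  have hB := S.contracted_bianchi m
  simp only [hcRb, tr_sub, hdiv, hRbt, hK1, hK2] at hB
  rw [map_sub, map_add, hnorm, hflip]
  have hT : S.δ m τ = S.t τ m := rfl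
  rw [hT]
  apply eq_of_two_mul_eq
  change _ + 2 * S.tr (fun j l => S.cov2 S.T j m l) + _ + _ - _ = 0 at hB
  linear_combination -hB + (S.δ m S.Sc + 2 * (S.tr fun h u => S.hess τ u m * S.t τ h)) *
    two_mul_half (A := A)

/-! ### Mixed tensors -/

/-- `Cⁱ_{jk} = g^{il} C_{ljk}`. -/
def CU (i j k : ι) : A := ∑ l, S.gi i l * S.C l j k

/-- `L^{ij}{}_k = g^{jl} Lⁱ_{lk}`. -/
def LU (i j k : ι) : A := ∑ l, S.gi j l * S.landsberg i l k

/-- The horizontal covariant derivative `Tᵗ_{ij|k}` of a tensor with one upper index. -/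
def cov12 (T : ι → ι → ι → A) (t i j k : ι) : A :=
  S.δ k (T t i j) + (∑ l, S.Γ t l k * T l i j) - (∑ l, S.Γ l i k * T t l j)
    - ∑ l, S.Γ l j k * T t i l

lemma cov12_CU (t i j k : ι) : S.cov12 S.CU t i j k = ∑ u, S.gi t u * S.cov3 S.C u i j k := by
  have h1 : S.δ k (S.CU t i j) = (∑ u, S.gi t u * S.δ k (S.C u i j))
      - (∑ l, S.Γ t l k * S.CU l i j) - ∑ u, S.gi t u * ∑ l, S.Γ l u k * S.C l i j := by
    have h2 : ∑ u, S.C u i j * ∑ l, S.Γ t l k * S.gi l u = ∑ l, S.Γ t l k * S.CU l i j := by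
      simp only [CU, Finset.mul_sum]
      rw [Finset.sum_comm]
      exact Finset.sum_congr rfl fun _ _ => Finset.sum_congr rfl fun _ _ => by ring
    have h3 : ∑ u, S.C u i j * ∑ l, S.Γ u l k * S.gi t l
        = ∑ u, S.gi t u * ∑ l, S.Γ l u k * S.C l i j := by
      simp only [Finset.mul_sum]
      rw [Finset.sum_comm]
      exact Finset.sum_congr rfl fun _ _ => Finset.sum_congr rfl fun _ _ => by ring
    rw [← h2, ← h3, CU, map_sum]
    simp only [Derivation.leibniz, smul_eq_mul, δ_gi, mul_neg, mul_add, Finset.sum_add_distrib,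
      Finset.sum_neg_distrib]
    ring
  have h4 : ∑ l, S.Γ l i k * S.CU t l j = ∑ u, S.gi t u * ∑ l, S.Γ l i k * S.C u l j := by
    simp only [CU, Finset.mul_sum]
    rw [Finset.sum_comm]
    exact Finset.sum_congr rfl fun _ _ => Finset.sum_congr rfl fun _ _ => by ring
  have h5 : ∑ l, S.Γ l j k * S.CU t i l = ∑ u, S.gi t u * ∑ l, S.Γ l j k * S.C u i l := by
    simp only [CU, Finset.mul_sum]
    rw [Finset.sum_comm]
    exact Finset.sum_congr rfl fun _ _ => Finset.sum_congr rfl fun _ _ => by ring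
  rw [cov12, h1, h4, h5]
  simp only [cov3, mul_sub, Finset.sum_sub_distrib]
  ring

/-- The tensor `Cᵗ_{ms}{}^{|i} - Cᵗ_{ml} L^{li}{}_s`, that is `W` with two indices raised. -/
def V (t m s i : ι) : A :=
  (∑ j, S.gi i j * S.cov12 S.CU t m s j) - ∑ l, S.CU t m l * S.LU l i s

lemma V_eq (t m s i : ι) : S.V t m s i = ∑ j, S.gi i j * ∑ u, S.gi t u * S.W u m s j := by
  have h : ∑ l, S.CU t m l * S.LU l i s
      = ∑ j, S.gi i j * ∑ u, S.gi t u * ∑ p, S.C u m p * S.landsberg p j s := by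
    simp only [CU, LU, Finset.sum_mul, Finset.mul_sum]
    rw [Finset.sum_comm]
    refine Finset.sum_congr rfl fun _ _ => ?_
    rw [Finset.sum_comm]
    exact Finset.sum_congr rfl fun _ _ => Finset.sum_congr rfl fun _ _ => by ring
  rw [V, h, ← Finset.sum_sub_distrib]
  simp only [cov12_CU, W, mul_sub, Finset.sum_sub_distrib]

lemma T_eq (a b : ι) : S.T a b = ∑ t, ∑ s, S.CU t a s * S.flag s t b := by
  rw [T, ← tr_swap]
  simp only [tr, CR, CU, Finset.sum_mul, Finset.mul_sum]
  refine Finset.sum_congr rfl fun _ _ => ?_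
  rw [Finset.sum_comm]
  exact Finset.sum_congr rfl fun _ _ => Finset.sum_congr rfl fun _ _ => by ring

/-- The index functions `a` and `b` make the lemma apply both to `V t m s i * flag s t i` and to
`V t i s i * flag s t m`. -/
lemma sum_V_mul_flag (a b : ι → ι) : ∑ t, ∑ s, ∑ i, S.V t (a i) s i * S.flag s t (b i)
    = S.tr (fun i j => S.tr fun t u => S.WR u (a i) j t (b i)) := by
  have h : ∀ t i, ∑ s, S.V t (a i) s i * S.flag s t (b i)
      = ∑ j, S.gi i j * ∑ u, S.gi t u * S.WR u (a i) j t (b i) := fun t i => by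
    simp only [V_eq, WR, Finset.sum_mul, Finset.mul_sum]
    rw [Finset.sum_comm]
    refine Finset.sum_congr rfl fun _ _ => ?_
    rw [Finset.sum_comm]
    exact Finset.sum_congr rfl fun _ _ => Finset.sum_congr rfl fun _ _ => by ring
  calc _ = ∑ t, ∑ i, ∑ j, S.gi i j * ∑ u, S.gi t u * S.WR u (a i) j t (b i) := by
        refine Finset.sum_congr rfl fun t _ => ?_
        rw [Finset.sum_comm]
        exact Finset.sum_congr rfl fun i _ => h t i
    _ = _ := by
        simp only [tr]
        rw [Finset.sum_comm]
        refine Finset.sum_congr rfl fun i _ => ?_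
        rw [Finset.sum_comm]
        simp only [Finset.mul_sum]

lemma Sc_eq : S.Sc = ∑ i, ∑ j, ∑ k, S.gi i j * S.riem i k k j := by
  have h : ∀ k l, S.tr (fun i j => S.Rm k i j l) = ∑ j, S.riem k j j l := fun k l => by
    rw [← tr_swap, tr]
    exact Finset.sum_congr rfl fun j _ => S.sum_gi_mul_sum_g (fun h => S.riem k h j l) j
  have h1 : S.Sc = S.tr fun i j => S.tr fun k l => S.Rm k i j l := rfl
  rw [h1, tr_comm]
  simp only [h]
  simp only [tr, Finset.mul_sum]

/-- `soliton_identity` with all contractions written as sums over mixed tensors. -/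
theorem soliton_identity_expanded {τ : A}
    (hτ : ∀ s, S.Y s τ = ∑ a, ∑ b, S.gi a b * S.C a b s)
    (hsol : ∀ i j, S.Rb i j + S.hess τ i j + (S.Rb j i + S.hess τ j i) = S.g i j) (m : ι) :
    half A * S.δ m (S.Sc + (∑ i, ∑ j, S.gi i j * S.δ i τ * S.δ j τ) - τ)
      + ∑ i, (∑ j, S.gi i j * S.δ j τ) *
          ∑ t, ∑ s, (S.CU t m s * S.flag s t i - S.CU t i s * S.flag s t m) =
    (∑ i, ∑ j, S.gi i j * S.cov2 (fun a b => ∑ t, ∑ s, S.CU t a s * S.flag s t b) m i j)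
      + (∑ t, ∑ s, ∑ i, S.V t m s i * S.flag s t i)
      + ∑ t, ∑ s, ∑ i, - S.V t i s i * S.flag s t m := by
  have h := S.soliton_identity hτ hsol m
  have h1 : ∑ i, ∑ j, S.gi i j * S.δ i τ * S.δ j τ = S.tr fun i j => S.t τ i * S.t τ j := by
    simp only [tr, t, mul_assoc]
  have h2 : ∑ i, (∑ j, S.gi i j * S.δ j τ) *
      ∑ t, ∑ s, (S.CU t m s * S.flag s t i - S.CU t i s * S.flag s t m)
      = S.tr (fun i j => S.t τ j * (S.T m i - S.T i m)) := by
    simp only [tr, t, T_eq, Finset.sum_sub_distrib, Finset.sum_mul, mul_assoc]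
  have h3 : ∑ t, ∑ s, ∑ i, - S.V t i s i * S.flag s t m
      = - S.tr (fun i j => S.tr fun t u => S.WR u i j t m) := by
    rw [← S.sum_V_mul_flag (fun i => i) fun _ => m]
    simp only [neg_mul, Finset.sum_neg_distrib]
  have h4 : S.T = fun a b => ∑ t, ∑ s, S.CU t a s * S.flag s t b := funext₂ S.T_eq
  rw [h1, h2, h3, S.sum_V_mul_flag (fun _ => m) fun i => i, h, h4, tr]
  ring

end FinslerAlgebra

/-! ### Jacobi's formula -/

lemma derivation_prod {A κ : Type*} [CommRing A] [Algebra ℝ A] [DecidableEq κ]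
    (D : Derivation ℝ A A) (s : Finset κ) (f : κ → A) :
    D (∏ i ∈ s, f i) = ∑ i ∈ s, D (f i) * ∏ j ∈ s.erase i, f j := by
  induction s using Finset.induction_on with
  | empty => simp
  | insert a s ha ih =>
    rw [Finset.prod_insert ha, Derivation.leibniz, ih, Finset.sum_insert ha,
      Finset.erase_insert ha, smul_eq_mul, smul_eq_mul, Finset.mul_sum, mul_comm (∏ i ∈ s, f i),
      add_comm]
    congr 1
    refine Finset.sum_congr rfl fun i hi => ?_
    have hia : a ≠ i := fun h => ha (h ▸ hi)
    rw [Finset.erase_insert_of_ne hia, Finset.prod_insert (fun h => ha (Finset.mem_of_mem_erase h))]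
    ring

/-- Jacobi's formula for the derivative of a determinant. -/
lemma derivation_det {A ι : Type*} [CommRing A] [Algebra ℝ A] [Fintype ι] [DecidableEq ι]
    (D : Derivation ℝ A A) (M H : Matrix ι ι A) (hH : H * M = 1) :
    D M.det = M.det * ∑ i, ∑ k, H i k * D (M k i) := by
  have h1 : D M.det = ∑ i, (M.updateCol i (fun k => D (M k i))).det := by
    simp only [Matrix.det_apply', map_sum, Derivation.leibniz, smul_eq_mul, Derivation.map_intCast,
      mul_zero, add_zero]
    rw [Finset.sum_comm]
    refine Finset.sum_congr rfl fun σ _ => ?_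
    rw [derivation_prod, Finset.mul_sum]
    refine Finset.sum_congr rfl fun i hi => ?_
    rw [← Finset.mul_prod_erase _ _ hi, Matrix.updateCol_self]
    congr 2
    refine Finset.prod_congr rfl fun j hj => ?_
    rw [Matrix.updateCol_ne (Finset.ne_of_mem_erase hj)]
  have h2 : M.adjugate = M.det • H := by
    calc M.adjugate = H * M * M.adjugate := by rw [hH, one_mul]
      _ = M.det • H := by rw [mul_assoc, Matrix.mul_adjugate, Matrix.mul_smul, mul_one]
  rw [h1, Finset.mul_sum]
  refine Finset.sum_congr rfl fun i _ => ?_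
  rw [← Matrix.cramer_apply, Matrix.cramer_eq_adjugate_mulVec, h2, Matrix.smul_mulVec]
  simp [Matrix.mulVec, dotProduct]

/-! ### The algebra of smooth functions on an open set -/

section SmoothFunctions

variable {E : Type*} [NormedAddCommGroup E] [NormedSpace ℝ E]

/-- The algebra of smooth functions on an open set `Ω`, as functions on the subtype that are
restrictions of functions on `E` smooth on `Ω`. -/
def smoothOn (Ω : TopologicalSpace.Opens E) : Subalgebra ℝ (Ω → ℝ) where
  carrier := {f | ∃ F : E → ℝ, ContDiffOn ℝ ∞ F Ω ∧ ∀ p : Ω, F p = f p}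
  mul_mem' := fun ⟨F, hF, h⟩ ⟨G, hG, h'⟩ => ⟨F * G, hF.mul hG, fun p => by simp [h, h']⟩
  add_mem' := fun ⟨F, hF, h⟩ ⟨G, hG, h'⟩ => ⟨F + G, hF.add hG, fun p => by simp [h, h']⟩
  algebraMap_mem' := fun r => ⟨fun _ => r, contDiffOn_const, fun p => rfl⟩

variable {Ω : TopologicalSpace.Opens E}

/-- The restriction to `Ω` of a function that is smooth there. -/
def toSmoothOn (F : E → ℝ) (hF : ContDiffOn ℝ ∞ F Ω) : smoothOn Ω :=
  ⟨fun p => F p, F, hF, fun _ => rfl⟩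

/-- Evaluation at a point. -/
def ev (p : Ω) : smoothOn Ω →ₐ[ℝ] ℝ := (Pi.evalAlgHom ℝ (fun _ : Ω => ℝ) p).comp (smoothOn Ω).val

lemma smoothOn_ext {a b : smoothOn Ω} (h : ∀ p, ev p a = ev p b) : a = b :=
  Subtype.ext (funext h)

@[simp] lemma ev_toSmoothOn (F : E → ℝ) (hF : ContDiffOn ℝ ∞ F Ω) (p : Ω) :
    ev p (toSmoothOn F hF) = F p := rfl

/-- A function on the whole space restricting to `a`; its values off `Ω` are unspecified. -/
def extend (a : smoothOn Ω) : E → ℝ := a.2.choose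

lemma contDiffOn_extend (a : smoothOn Ω) : ContDiffOn ℝ ∞ (extend a) Ω := a.2.choose_spec.1

lemma extend_apply (a : smoothOn Ω) (p : Ω) : extend a p = ev p a := a.2.choose_spec.2 p

lemma eventuallyEq_extend {a : smoothOn Ω} {F : E → ℝ} (h : ∀ p : Ω, F p = ev p a) (p : Ω) :
    F =ᶠ[nhds (p : E)] extend a := by
  filter_upwards [Ω.isOpen.mem_nhds p.2] with q hq
  rw [extend_apply a ⟨q, hq⟩, ← h]

lemma hasFDerivAt_extend (a : smoothOn Ω) (p : Ω) :
    HasFDerivAt (extend a) (fderiv ℝ (extend a) p) p :=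
  (((contDiffOn_extend a).contDiffAt (Ω.isOpen.mem_nhds p.2)).differentiableAt
    (by simp)).hasFDerivAt

lemma hasFDerivAt_of_eq {a : smoothOn Ω} {F : E → ℝ} (h : ∀ p : Ω, F p = ev p a) (p : Ω) :
    HasFDerivAt F (fderiv ℝ (extend a) p) p :=
  (hasFDerivAt_extend a p).congr_of_eventuallyEq (eventuallyEq_extend h p)

lemma contDiffOn_fderiv_extend (a : smoothOn Ω) : ContDiffOn ℝ ∞ (fderiv ℝ (extend a)) Ω :=
  (contDiffOn_extend a).fderiv_of_isOpen Ω.isOpen (by simp)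

/-- The derivative in the direction of a fixed vector. As `Ω` is open, the extension chosen is
immaterial. -/
def dirDeriv (v : E) : Derivation ℝ (smoothOn Ω) (smoothOn Ω) :=
  Derivation.mk'
    { toFun := fun a => toSmoothOn (fun p => fderiv ℝ (extend a) p v)
        ((contDiffOn_fderiv_extend a).clm_apply contDiffOn_const)
      map_add' := fun a b => smoothOn_ext fun p => by
        have h := hasFDerivAt_of_eq (a := a + b) (F := extend a + extend b)
          (fun p => by simp [extend_apply]) p
        simp [h.unique ((hasFDerivAt_extend a p).add (hasFDerivAt_extend b p))]
      map_smul' := fun r a => smoothOn_ext fun p => by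
        have h := hasFDerivAt_of_eq (a := r • a) (F := r • extend a)
          (fun p => by simp [extend_apply]) p
        simp [h.unique ((hasFDerivAt_extend a p).const_smul r)] }
    fun a b => smoothOn_ext fun p => by
      have h := hasFDerivAt_of_eq (a := a * b) (F := extend a * extend b)
        (fun p => by simp [extend_apply]) p
      simp [h.unique ((hasFDerivAt_extend a p).mul (hasFDerivAt_extend b p)), extend_apply]

lemma ev_dirDeriv {a : smoothOn Ω} {F : E → ℝ} (h : ∀ p : Ω, F p = ev p a) {p : Ω} {F' : E →L[ℝ] ℝ}
    (hF : HasFDerivAt F F' p) (v : E) : ev p (dirDeriv v a) = F' v := by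
  rw [← (hasFDerivAt_of_eq h p).unique hF]; rfl

lemma dirDeriv_comm (u v : E) (a : smoothOn Ω) :
    dirDeriv u (dirDeriv v a) = dirDeriv v (dirDeriv u a) := by
  refine smoothOn_ext fun p => ?_
  have h : ∀ u v : E, ev p (dirDeriv u (dirDeriv v a)) =
      fderiv ℝ (fderiv ℝ (extend a)) p u v := fun u v => by
    have h1 : HasFDerivAt (fderiv ℝ (extend a)) (fderiv ℝ (fderiv ℝ (extend a)) p) p :=
      (((contDiffOn_fderiv_extend a).contDiffAt (Ω.isOpen.mem_nhds p.2)).differentiableAt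
        (by simp)).hasFDerivAt
    exact ev_dirDeriv (a := dirDeriv v a) (F := fun q => fderiv ℝ (extend a) q v) (fun q => rfl)
      (h1.clm_apply (hasFDerivAt_const v _)) u |>.trans (by simp)
  rw [h, h]
  exact ((contDiffOn_extend a).contDiffAt (Ω.isOpen.mem_nhds p.2)).isSymmSndFDerivAt
    (by rw [minSmoothness_of_isRCLikeNormedField]; exact WithTop.coe_le_coe.2 le_top) _ _

lemma isUnit_of_ev_ne_zero {a : smoothOn Ω} (h : ∀ p, ev p a ≠ 0) : IsUnit a := by
  have h1 : ∀ q ∈ (Ω : Set E), extend a q ≠ 0 := fun q hq => by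
    rw [extend_apply a ⟨q, hq⟩]; exact h _
  refine IsUnit.of_mul_eq_one (toSmoothOn (fun q => (extend a q)⁻¹) ((contDiffOn_extend a).inv h1))
    (smoothOn_ext fun p => ?_)
  rw [map_mul, ev_toSmoothOn, extend_apply, map_one, mul_inv_cancel₀ (h p)]

/-- The logarithm of a positive smooth function. -/
def logSmooth (a : smoothOn Ω) (h : ∀ p, 0 < ev p a) : smoothOn Ω :=
  toSmoothOn (fun q => Real.log (extend a q)) ((contDiffOn_extend a).log fun q hq => by
    rw [extend_apply a ⟨q, hq⟩]; exact (h _).ne')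

lemma ev_logSmooth (a : smoothOn Ω) (h : ∀ p, 0 < ev p a) (p : Ω) :
    ev p (logSmooth a h) = Real.log (ev p a) := by
  rw [logSmooth, ev_toSmoothOn, extend_apply]

lemma mul_dirDeriv_logSmooth (a : smoothOn Ω) (h : ∀ p, 0 < ev p a) (v : E) :
    a * dirDeriv v (logSmooth a h) = dirDeriv v a := by
  refine smoothOn_ext fun p => ?_
  have h1 := ev_dirDeriv (a := logSmooth a h) (F := fun q => Real.log (extend a q)) (fun q => rfl)
    ((hasFDerivAt_extend a p).log (by rw [extend_apply]; exact (h p).ne')) v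
  rw [map_mul, h1, ev_dirDeriv (fun p => extend_apply a p) (hasFDerivAt_extend a p), extend_apply]
  simp [(h p).ne']

end SmoothFunctions

/-! ### Finsler metrics in a coordinate domain -/

section LocalCoordinates

variable {n : ℕ}

/-- The slit domain `U × (ℝⁿ \ 0)`. -/
def slit (U : TopologicalSpace.Opens (Coord n)) : TopologicalSpace.Opens (Coord n × Coord n) :=
  ⟨{p | p.1 ∈ U ∧ p.2 ≠ 0},
    (U.isOpen.preimage continuous_fst).inter (isOpen_ne_fun continuous_snd continuous_const)⟩

/-- `F` is a Finsler metric on the coordinate domain `U`. -/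
structure IsLocalMetric (U : TopologicalSpace.Opens (Coord n)) (F : LocalFun n) : Prop where
  smooth : ContDiffOn ℝ ∞ (fun p : Coord n × Coord n => F p.1 p.2) (slit U)
  homogeneous : ∀ x ∈ U, ∀ (y : Coord n), y ≠ 0 → ∀ t : ℝ, 0 < t → F x (t • y) = t * F x y
  posDef : ∀ x ∈ U, ∀ (y : Coord n), y ≠ 0 → (gMatrix F x y).PosDef

variable {U : TopologicalSpace.Opens (Coord n)}

/-- The coordinate expression `f` agrees with `a` on the slit domain. -/
def Represents (f : LocalFun n) (a : smoothOn (slit U)) : Prop :=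
  ∀ p : slit U, f p.1.1 p.1.2 = ev p a

/-- The derivation `∂/∂xⁱ`. -/
def derivX (U : TopologicalSpace.Opens (Coord n)) (i : Fin n) :
    Derivation ℝ (smoothOn (slit U)) (smoothOn (slit U)) :=
  dirDeriv (EuclideanSpace.single i 1, 0)

/-- The derivation `∂/∂yⁱ`. -/
def derivY (U : TopologicalSpace.Opens (Coord n)) (i : Fin n) :
    Derivation ℝ (smoothOn (slit U)) (smoothOn (slit U)) :=
  dirDeriv (0, EuclideanSpace.single i 1)

lemma Represents.dx {f : LocalFun n} {a : smoothOn (slit U)} (h : Represents f a) (i : Fin n) :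
    Represents (dx i f) (derivX U i a) := fun p => by
  have h1 := hasFDerivAt_of_eq (F := fun q : Coord n × Coord n => f q.1 q.2) h p
  have h0 : HasFDerivAt (fun x' : Coord n => ((x', p.1.2) : Coord n × Coord n))
      (ContinuousLinearMap.inl ℝ (Coord n) (Coord n)) p.1.1 := hasFDerivAt_prodMk_left p.1.1 p.1.2
  have h2 : HasFDerivAt (fun x' => f x' p.1.2) ((fderiv ℝ (extend a) p).comp
      (ContinuousLinearMap.inl ℝ (Coord n) (Coord n))) p.1.1 :=
    HasFDerivAt.comp (g := fun q : Coord n × Coord n => f q.1 q.2) p.1.1 h1 h0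
  rw [derivX, ev_dirDeriv (F := fun q : Coord n × Coord n => f q.1 q.2) h h1, Finsler.dx]
  rw [h2.fderiv]
  simp

lemma Represents.dy {f : LocalFun n} {a : smoothOn (slit U)} (h : Represents f a) (i : Fin n) :
    Represents (dy i f) (derivY U i a) := fun p => by
  have h1 := hasFDerivAt_of_eq (F := fun q : Coord n × Coord n => f q.1 q.2) h p
  have h0 : HasFDerivAt (fun x' : Coord n => ((p.1.1, x') : Coord n × Coord n))
      (ContinuousLinearMap.inr ℝ (Coord n) (Coord n)) p.1.2 := hasFDerivAt_prodMk_right p.1.1 p.1.2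
  have h2 : HasFDerivAt (fun y' => f p.1.1 y') ((fderiv ℝ (extend a) p).comp
      (ContinuousLinearMap.inr ℝ (Coord n) (Coord n))) p.1.2 :=
    HasFDerivAt.comp (g := fun q : Coord n × Coord n => f q.1 q.2) p.1.2 h1 h0
  rw [derivY, ev_dirDeriv (F := fun q : Coord n × Coord n => f q.1 q.2) h h1, Finsler.dy]
  rw [h2.fderiv]
  simp

@[simp] lemma ev_half (p : slit U) : ev p (half (smoothOn (slit U))) = 1 / 2 :=
  (ev p).commutes _

variable {F : LocalFun n} (hF : IsLocalMetric U F)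

/-- `F²` as a smooth function. -/
def sqFun : smoothOn (slit U) :=
  toSmoothOn (fun p => F p.1 p.2 ^ 2) (hF.smooth.pow 2)

/-- The fibre coordinate `yⁱ`. -/
def coordY (U : TopologicalSpace.Opens (Coord n)) (i : Fin n) : smoothOn (slit U) :=
  toSmoothOn (fun p => p.2 i) (by fun_prop)

lemma represents_sq : Represents (sq F) (sqFun hF) := fun _ => rfl

/-- The fundamental tensor as a matrix of smooth functions. -/
def gMat : Matrix (Fin n) (Fin n) (smoothOn (slit U)) :=
  Matrix.of fun i j => half _ * derivY U i (derivY U j (sqFun hF))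

lemma ev_gMat (p : slit U) : (gMat hF).map (ev p) = gMatrix F p.1.1 p.1.2 := by
  ext i j
  rw [Matrix.map_apply, gMat, Matrix.of_apply, map_mul, ev_half,
    ← (((represents_sq hF).dy j).dy i) p]
  rfl

lemma det_gMat_pos (p : slit U) : 0 < ev p (gMat hF).det := by
  have h : ev p (gMat hF).det = ((gMat hF).map (ev p)).det :=
    RingHom.map_det (ev p : smoothOn (slit U) →+* ℝ) (gMat hF)
  rw [h, ev_gMat]
  exact (hF.posDef _ p.2.1 _ p.2.2).det_pos

lemma isUnit_det_gMat : IsUnit (gMat hF).det :=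
  isUnit_of_ev_ne_zero fun p => (det_gMat_pos hF p).ne'

/-- Euler's relation, by differentiating `F²(x, ty) = t² F²(x, y)` at `t = 1`. -/
lemma euler_sqFun : ∑ k, coordY U k * derivY U k (sqFun hF) = 2 * sqFun hF := by
  refine smoothOn_ext fun p => ?_
  obtain ⟨⟨x, y⟩, hx, hy⟩ := p
  set p : slit U := ⟨(x, y), hx, hy⟩
  have h1 := hasFDerivAt_of_eq (F := fun q : Coord n × Coord n => F q.1 q.2 ^ 2)
    (represents_sq hF) p
  set D := fderiv ℝ (extend (sqFun hF)) (x, y)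
  have h2 : ∀ k, ev p (derivY U k (sqFun hF)) = D (0, EuclideanSpace.single k 1) :=
    fun k => ev_dirDeriv (F := fun q : Coord n × Coord n => F q.1 q.2 ^ 2) (represents_sq hF) h1 _
  have hy' : y = ∑ k, y k • EuclideanSpace.single k (1 : ℝ) := by
    ext i; simp [Finset.sum_apply, Pi.single_apply]
  have h3 : ∑ k, y k * D (0, EuclideanSpace.single k 1) = D (0, y) := by
    have : ((0 : Coord n), y) = ∑ k, y k • ((0 : Coord n), EuclideanSpace.single k (1 : ℝ)) := by
      conv_lhs => rw [hy']
      ext1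
      · simp [Prod.fst_sum]
      · simp [Prod.snd_sum]
    rw [this, map_sum]
    simp only [map_smul, smul_eq_mul]
  have h4 : HasDerivAt (fun t : ℝ => F x (t • y) ^ 2) (D (0, y)) 1 := by
    have h5 : HasDerivAt (fun t : ℝ => (x, t • y)) ((0 : Coord n), y) 1 := by
      have := (hasDerivAt_id (1 : ℝ)).smul_const y
      simpa using (hasDerivAt_const (1 : ℝ) x).prodMk this
    have h1' : HasFDerivAt (fun q : Coord n × Coord n => F q.1 q.2 ^ 2) D (x, (1 : ℝ) • y) := by
      simpa using h1
    exact h1'.comp_hasDerivAt 1 h5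
  have h6 : HasDerivAt (fun t : ℝ => F x (t • y) ^ 2) (2 * F x y ^ 2) 1 := by
    have h7 : HasDerivAt (fun t : ℝ => t ^ 2 * F x y ^ 2) (2 * F x y ^ 2) 1 := by
      simpa using (hasDerivAt_pow 2 (1 : ℝ)).mul_const (F x y ^ 2)
    refine h7.congr_of_eventuallyEq ?_
    filter_upwards [lt_mem_nhds (zero_lt_one (α := ℝ))] with t ht
    rw [hF.homogeneous x hx y hy t ht]; ring
  have h8 : ∀ k, ev p (coordY U k) = y k := fun k => rfl
  simp only [map_sum, map_mul, h2, h8, h3, h4.unique h6, map_ofNat]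
  rfl

lemma derivX_coordY (i j : Fin n) : derivX U i (coordY U j) = 0 := by
  refine smoothOn_ext fun p => ?_
  rw [derivX, ev_dirDeriv (F := fun q : Coord n × Coord n => q.2 j) (fun _ => rfl)
    ((EuclideanSpace.proj j : Coord n →L[ℝ] ℝ).comp
      (ContinuousLinearMap.snd ℝ (Coord n) (Coord n))).hasFDerivAt]
  simp

lemma derivY_coordY (i j : Fin n) : derivY U i (coordY U j) = if i = j then 1 else 0 := by
  refine smoothOn_ext fun p => ?_
  rw [derivY, ev_dirDeriv (F := fun q : Coord n × Coord n => q.2 j) (fun _ => rfl)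
    ((EuclideanSpace.proj j : Coord n →L[ℝ] ℝ).comp
      (ContinuousLinearMap.snd ℝ (Coord n) (Coord n))).hasFDerivAt]
  by_cases h : i = j
  · subst h; simp
  · simp [h, Ne.symm h]

/-- The algebra of smooth functions on the slit domain, with the structure given by a local Finsler
metric. -/
def localAlgebra : FinslerAlgebra (Fin n) (smoothOn (slit U)) where
  X := derivX U
  Y := derivY U
  X_X _ _ _ := dirDeriv_comm _ _ _
  Y_Y _ _ _ := dirDeriv_comm _ _ _
  X_Y _ _ _ := dirDeriv_comm _ _ _
  y := coordY U
  X_y := derivX_coordY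
  Y_y := derivY_coordY
  Q := sqFun hF
  euler := euler_sqFun hF
  gi i j := (gMat hF)⁻¹ i j
  gi_mul_g i k := by
    have h := congrFun (congrFun (Matrix.nonsing_inv_mul _ (isUnit_det_gMat hF)) i) k
    rw [Matrix.mul_apply, Matrix.one_apply] at h
    exact h

variable (F) in
lemma gInv_eq (p : slit U) (i j : Fin n) (hF : IsLocalMetric U F) :
    gInv F i j p.1.1 p.1.2 = ev p ((localAlgebra hF).gi i j) := by
  have h : ((gMat hF)⁻¹).map (ev p) * (gMat hF).map (ev p) = 1 := by
    have := congrArg (fun M : Matrix _ _ _ => M.map (ev p))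
      (Matrix.nonsing_inv_mul _ (isUnit_det_gMat hF))
    simpa [Matrix.map_mul, Matrix.map_one] using this
  rw [gInv, ← ev_gMat hF p, Matrix.inv_eq_left_inv h]
  rfl

/-! ### Coordinate expressions as elements of the algebra -/

lemma represents_g (i j : Fin n) : Represents (g F i j) ((localAlgebra hF).g i j) := fun p => by
  rw [FinslerAlgebra.g, map_mul, ev_half]
  exact congrArg _ ((((represents_sq hF).dy j).dy i) p)

lemma represents_gInv (i j : Fin n) : Represents (gInv F i j) ((localAlgebra hF).gi i j) :=
  fun p => gInv_eq F p i j hF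

lemma represents_cartan (i j k : Fin n) : Represents (cartan F i j k) ((localAlgebra hF).C i j k) :=
  fun p => by
  rw [FinslerAlgebra.C, map_mul, map_mul, ev_half, cartan,
    (((represents_sq hF).dy k).dy j).dy i p]
  norm_num
  rfl

lemma represents_cartanUp (i j k : Fin n) :
    Represents (cartanUp F i j k) ((localAlgebra hF).CU i j k) := fun p => by
  simp only [FinslerAlgebra.CU, map_sum, map_mul, ← represents_gInv hF _ _ p,
    ← represents_cartan hF _ _ _ p]
  rfl

lemma represents_spray (i : Fin n) : Represents (spray F i) ((localAlgebra hF).spray i) :=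
  fun p => by
  have h1 : ∀ j k, ev p ((localAlgebra hF).X k ((localAlgebra hF).Y j (localAlgebra hF).Q))
      = dx k (dy j (sq F)) p.1.1 p.1.2 :=
    fun j k => ((((represents_sq hF).dy j).dx k) p).symm
  have h2 : ∀ j, ev p ((localAlgebra hF).X j (localAlgebra hF).Q) = dx j (sq F) p.1.1 p.1.2 :=
    fun j => (((represents_sq hF).dx j) p).symm
  have h3 : ∀ k, ev p ((localAlgebra hF).y k) = p.1.2 k := fun k => rfl
  simp only [FinslerAlgebra.spray, FinslerAlgebra.s, map_sum, map_mul, map_sub, ev_half, h1, h2, h3,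
    ← represents_gInv hF _ _ p]
  rw [spray]; norm_num

lemma represents_nonlinConn (i j : Fin n) :
    Represents (nonlinConn F i j) ((localAlgebra hF).N i j) :=
  (represents_spray hF i).dy j

lemma Represents.hd {f : LocalFun n} {a : smoothOn (slit U)} (h : Represents f a) (i : Fin n) :
    Represents (hd F i f) ((localAlgebra hF).δ i a) := fun p => by
  have h1 : ∀ j, ev p ((localAlgebra hF).Y j a) = Finsler.dy j f p.1.1 p.1.2 :=
    fun j => (h.dy j p).symm
  have h2 : ev p ((localAlgebra hF).X i a) = Finsler.dx i f p.1.1 p.1.2 := (h.dx i p).symm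
  simp only [FinslerAlgebra.δ_apply, map_sub, map_sum, map_mul, h1, h2,
    ← represents_nonlinConn hF _ _ p]
  rfl

lemma represents_chern (i j k : Fin n) : Represents (chern F i j k) ((localAlgebra hF).Γ i j k) :=
  fun p => by
  simp only [FinslerAlgebra.Γ, map_sum, map_mul, map_sub, map_add, ev_half,
    ← represents_gInv hF _ _ p, ← (represents_g hF _ _).hd hF _ p]
  rfl

lemma represents_riem (j i k l : Fin n) :
    Represents (riem F j i k l) ((localAlgebra hF).riem j i k l) := fun p => by
  simp only [FinslerAlgebra.riem, map_sum, map_mul, map_sub, map_add,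
    ← represents_chern hF _ _ _ p, ← (represents_chern hF _ _ _).hd hF _ p]
  rfl

lemma represents_flag (i k l : Fin n) : Represents (flag F i k l) ((localAlgebra hF).flag i k l) :=
  fun p => by
  have h : ∀ k, ev p ((localAlgebra hF).y k) = p.1.2 k := fun k => rfl
  simp only [FinslerAlgebra.flag, map_sum, map_mul, h, ← represents_riem hF _ _ _ _ p]
  rfl

lemma represents_landsberg (i j k : Fin n) :
    Represents (landsberg F i j k) ((localAlgebra hF).landsberg i j k) := fun p => by
  rw [FinslerAlgebra.landsberg, map_sub, ← represents_chern hF _ _ _ p]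
  exact congrArg (· - _) (((represents_spray hF i).dy k).dy j p)

lemma represents_landsbergUp (i j k : Fin n) :
    Represents (landsbergUp F i j k) ((localAlgebra hF).LU i j k) := fun p => by
  simp only [FinslerAlgebra.LU, map_sum, map_mul, ← represents_gInv hF _ _ p,
    ← represents_landsberg hF _ _ _ p]
  rfl

lemma Represents.hcov1 {T : Fin n → LocalFun n} {T' : Fin n → smoothOn (slit U)}
    (h : ∀ i, Represents (T i) (T' i)) (i k : Fin n) :
    Represents (hcov1 F T i k) ((localAlgebra hF).cov1 T' i k) := fun p => by
  simp only [FinslerAlgebra.cov1, map_sum, map_mul, map_sub, ← represents_chern hF _ _ _ p,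
    ← (h _).hd hF _ p, ← h _ p]
  rfl

lemma Represents.hcov2 {T : Fin n → Fin n → LocalFun n} {T' : Fin n → Fin n → smoothOn (slit U)}
    (h : ∀ i j, Represents (T i j) (T' i j)) (i j k : Fin n) :
    Represents (hcov2 F T i j k) ((localAlgebra hF).cov2 T' i j k) := fun p => by
  simp only [FinslerAlgebra.cov2, map_sum, map_mul, map_sub, ← represents_chern hF _ _ _ p,
    ← (h _ _).hd hF _ p, ← h _ _ p]
  rfl

lemma Represents.hcov12 {T : Fin n → Fin n → Fin n → LocalFun n}
    {T' : Fin n → Fin n → Fin n → smoothOn (slit U)}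
    (h : ∀ t i j, Represents (T t i j) (T' t i j)) (t i j k : Fin n) :
    Represents (hcov12 F T t i j k) ((localAlgebra hF).cov12 T' t i j k) := fun p => by
  simp only [FinslerAlgebra.cov12, map_sum, map_mul, map_sub, map_add,
    ← represents_chern hF _ _ _ p, ← (h _ _ _).hd hF _ p, ← h _ _ _ p]
  rfl

lemma represents_ricBar (i j : Fin n) : Represents (ricBar F i j) ((localAlgebra hF).Rb i j) :=
  fun p => by
  simp only [FinslerAlgebra.Rb, FinslerAlgebra.tr, FinslerAlgebra.Rm, map_sum, map_mul,
    ← represents_gInv hF _ _ p, ← represents_g hF _ _ p, ← represents_riem hF _ _ _ _ p,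
    Finset.mul_sum, ← mul_assoc]
  rfl

lemma represents_scalarCurv : Represents (scalarCurv F) (localAlgebra hF).Sc := fun p => by
  simp only [FinslerAlgebra.Sc_eq, map_sum, map_mul, ← represents_gInv hF _ _ p,
    ← represents_riem hF _ _ _ _ p]
  rfl

lemma represents_keyForm (m : Fin n) : Represents (keyForm F m)
    ((∑ i, ∑ j, (localAlgebra hF).gi i j * (localAlgebra hF).cov2 (fun a b => ∑ t, ∑ s,
        (localAlgebra hF).CU t a s * (localAlgebra hF).flag s t b) m i j)
      + (∑ t, ∑ s, ∑ i, (localAlgebra hF).V t m s i * (localAlgebra hF).flag s t i)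
      + ∑ t, ∑ s, ∑ i, - (localAlgebra hF).V t i s i * (localAlgebra hF).flag s t m) := fun p => by
  have h : ∀ a b, Represents (fun x y => ∑ t, ∑ s, cartanUp F t a s x y * flag F s t b x y)
      (∑ t, ∑ s, (localAlgebra hF).CU t a s * (localAlgebra hF).flag s t b) := fun a b p => by
    simp only [map_sum, map_mul, ← represents_cartanUp hF _ _ _ p, ← represents_flag hF _ _ _ p]
  simp only [FinslerAlgebra.V, map_add, map_sum, map_mul, map_sub,
    ← represents_gInv hF _ _ p, ← Represents.hcov2 hF h _ _ _ p,
    ← Represents.hcov12 hF (represents_cartanUp hF) _ _ _ _ p, ← represents_cartanUp hF _ _ _ p,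
    ← represents_landsbergUp hF _ _ _ p, ← represents_flag hF _ _ _ p, neg_sub]
  rfl

/-! ### The distortion of a measure -/

variable {σ : Coord n → ℝ} (hσ : ContDiffOn ℝ ∞ σ U) (hpos : ∀ x ∈ U, 0 < σ x)

/-- The density `σ(x)` as a function on the slit domain. -/
def densityFun : smoothOn (slit U) :=
  toSmoothOn (fun p => σ p.1) (hσ.comp contDiff_fst.contDiffOn fun _ hp => hp.1)

include hpos in
lemma densityFun_pos (p : slit U) : 0 < ev p (densityFun hσ) := hpos _ p.2.1

/-- The distortion, in the form `½ log det g - log σ`. -/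
def distortionFun : smoothOn (slit U) :=
  half _ * logSmooth (gMat hF).det (det_gMat_pos hF)
    - logSmooth (densityFun hσ) (densityFun_pos hσ hpos)

lemma represents_distortion : Represents (distortion F σ) (distortionFun hF hσ hpos) := fun p => by
  have h : ev p (gMat hF).det = (gMatrix F p.1.1 p.1.2).det := by
    rw [← ev_gMat hF]
    exact RingHom.map_det (ev p : smoothOn (slit U) →+* ℝ) (gMat hF)
  have hd := det_gMat_pos hF p
  have hs : ev p (densityFun hσ) = σ p.1.1 := rfl
  rw [distortionFun, map_sub, map_mul, ev_half, ev_logSmooth, ev_logSmooth, hs, distortion]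
  rw [h] at hd ⊢
  rw [Real.log_div (Real.sqrt_pos.2 hd).ne' (hpos _ p.2.1).ne', Real.log_sqrt hd.le]
  ring

lemma derivY_densityFun (i : Fin n) : derivY U i (densityFun hσ) = 0 :=
  smoothOn_ext fun p => by
  have h : HasFDerivAt σ (fderiv ℝ σ p.1.1) p.1.1 :=
    ((hσ.contDiffAt (U.isOpen.mem_nhds p.2.1)).differentiableAt (by simp)).hasFDerivAt
  have h1 : HasFDerivAt (fun q : Coord n × Coord n => σ q.1) _ (p : Coord n × Coord n) :=
    HasFDerivAt.comp (g := σ) (p : Coord n × Coord n) h hasFDerivAt_fst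
  rw [derivY, ev_dirDeriv (F := fun q : Coord n × Coord n => σ q.1) (fun _ => rfl) h1]
  simp

/-- The vertical derivative of the distortion is the mean Cartan tensor, by Jacobi's formula; the
density does not depend on `y`. -/
lemma derivY_distortionFun (s : Fin n) : (localAlgebra hF).Y s (distortionFun hF hσ hpos)
    = ∑ a, ∑ b, (localAlgebra hF).gi a b * (localAlgebra hF).C a b s := by
  have h1 : derivY U s (logSmooth (densityFun hσ) (densityFun_pos hσ hpos)) = 0 := by
    have h := mul_dirDeriv_logSmooth (densityFun hσ) (densityFun_pos hσ hpos)
      (0, EuclideanSpace.single s 1)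
    have h' := derivY_densityFun hσ s
    rw [derivY] at h'
    rw [h'] at h
    exact (isUnit_of_ev_ne_zero fun p => (densityFun_pos hσ hpos p).ne').mul_left_cancel
      (h.trans (mul_zero _).symm)
  have h2 : derivY U s (logSmooth (gMat hF).det (det_gMat_pos hF))
      = ∑ a, ∑ b, (localAlgebra hF).gi a b * (2 * (localAlgebra hF).C a b s) := by
    have h := mul_dirDeriv_logSmooth (gMat hF).det (det_gMat_pos hF)
      (0, EuclideanSpace.single s 1)
    have h' := derivation_det (derivY U s) (gMat hF) (gMat hF)⁻¹
      (Matrix.nonsing_inv_mul _ (isUnit_det_gMat hF))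
    rw [derivY] at h'
    rw [h'] at h
    rw [derivY, (isUnit_det_gMat hF).mul_left_cancel h]
    refine Finset.sum_congr rfl fun a _ => Finset.sum_congr rfl fun b _ => ?_
    rw [(localAlgebra hF).C_symm a b, ← (localAlgebra hF).Y_g s b a]
    rfl
  have h3 : (localAlgebra hF).Y s (distortionFun hF hσ hpos) = half _ *
      derivY U s (logSmooth (gMat hF).det (det_gMat_pos hF)) := by
    change derivY U s _ = _
    rw [distortionFun, map_sub, h1, sub_zero, Derivation.leibniz,
      FinslerAlgebra.derivation_half, smul_zero, add_zero, smul_eq_mul]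
  rw [h3, h2, Finset.mul_sum]
  refine Finset.sum_congr rfl fun a _ => ?_
  rw [Finset.mul_sum]
  refine Finset.sum_congr rfl fun b _ => ?_
  linear_combination ((localAlgebra hF).gi a b * (localAlgebra hF).C a b s) *
    FinslerAlgebra.two_mul_half (A := smoothOn (slit U))

/-- Polarization: a quadratic form determines the symmetric part of its matrix. -/
lemma add_swap_eq_of_quadratic_eq {a b : Fin n → Fin n → ℝ}
    (h : ∀ V : Coord n, ∑ i, ∑ j, a i j * V i * V j = ∑ i, ∑ j, b i j * V i * V j) (i j : Fin n) :
    a i j + a j i = b i j + b j i := by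
  have e : ∀ (c : Fin n → Fin n → ℝ) (i j : Fin n), ∑ k, ∑ l, c k l *
      (EuclideanSpace.single i (1 : ℝ) + EuclideanSpace.single j 1 : Coord n) k *
      (EuclideanSpace.single i (1 : ℝ) + EuclideanSpace.single j 1 : Coord n) l
      = c i i + c i j + c j i + c j j := fun c i j => by
    simp [mul_add, Finset.sum_add_distrib]
    ring
  -- Taking twice a basis vector lets the same expansion `e` serve for the diagonal terms.
  have hij := h (EuclideanSpace.single i 1 + EuclideanSpace.single j 1)
  have hii := h (EuclideanSpace.single i 1 + EuclideanSpace.single i 1)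
  have hjj := h (EuclideanSpace.single j 1 + EuclideanSpace.single j 1)
  rw [e, e] at hij hii hjj
  linarith

/-- The soliton identity for a Finsler metric on a coordinate domain. -/
theorem soliton_identity_local (hF : IsLocalMetric U F) {σ : Coord n → ℝ}
    (hσ : ContDiffOn ℝ ∞ σ U) (hpos : ∀ x ∈ U, 0 < σ x)
    (hsol : ∀ x ∈ U, ∀ y : Coord n, y ≠ 0 → ∀ V : Coord n,
      ∑ i, ∑ j, ricInfty F σ i j x y * V i * V j = 1 / 2 * ∑ i, ∑ j, g F i j x y * V i * V j)
    {x y : Coord n} (hx : x ∈ U) (hy : y ≠ 0) (m : Fin n) :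
    1 / 2 * hd F m (fun x y => scalarCurv F x y + hgradNormSq F (distortion F σ) x y
        - distortion F σ x y) x y
      + ∑ i, hgrad F (distortion F σ) i x y *
          ∑ t, ∑ s, (cartanUp F t m s x y * flag F s t i x y
            - cartanUp F t i s x y * flag F s t m x y)
      = keyForm F m x y := by
  obtain ⟨τ, hτ, hY⟩ : ∃ τ, Represents (distortion F σ) τ ∧ ∀ s, (localAlgebra hF).Y s τ
      = ∑ a, ∑ b, (localAlgebra hF).gi a b * (localAlgebra hF).C a b s :=
    ⟨distortionFun hF hσ hpos, represents_distortion hF hσ hpos,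
      derivY_distortionFun hF hσ hpos⟩
  have hsol' : ∀ i j, (localAlgebra hF).Rb i j + (localAlgebra hF).hess τ i j
      + ((localAlgebra hF).Rb j i + (localAlgebra hF).hess τ j i) = (localAlgebra hF).g i j :=
    fun i j => smoothOn_ext fun p => by
    have h := add_swap_eq_of_quadratic_eq (a := fun i j => ricInfty F σ i j p.1.1 p.1.2)
      (b := fun i j => 1 / 2 * g F i j p.1.1 p.1.2) (fun V => by
        rw [hsol _ p.2.1 _ p.2.2 V, Finset.mul_sum]
        simp only [Finset.mul_sum, mul_assoc]) i j
    have hr : ∀ i j, ricInfty F σ i j p.1.1 p.1.2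
        = ev p ((localAlgebra hF).Rb i j + (localAlgebra hF).hess τ i j) := fun i j => by
      rw [map_add, ← represents_ricBar hF i j p]
      exact congrArg _ (Represents.hcov1 hF (fun i => hτ.hd hF i) i j p)
    rw [map_add, ← hr, ← hr, h, represents_g hF i j p, represents_g hF j i p,
      (localAlgebra hF).g_symm j i]
    ring
  have h := congrArg (ev (⟨(x, y), hx, hy⟩ : slit U))
    ((localAlgebra hF).soliton_identity_expanded hY hsol' m)
  have hS : Represents (fun x y => scalarCurv F x y + hgradNormSq F (distortion F σ) x y
      - distortion F σ x y) ((localAlgebra hF).Sc + (∑ i, ∑ j, (localAlgebra hF).gi i j *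
        (localAlgebra hF).δ i τ * (localAlgebra hF).δ j τ) - τ) := fun p => by
    simp only [map_add, map_sub, map_sum, map_mul, ← represents_gInv hF _ _ p,
      ← hτ.hd hF _ p, ← hτ p, ← represents_scalarCurv hF p]
    rfl
  rw [map_add, map_mul, ev_half, ← hS.hd hF m, ← represents_keyForm hF m] at h
  simp only [map_sum, map_mul, map_sub, ← represents_gInv hF _ _ _, ← hτ.hd hF _ _,
    ← represents_cartanUp hF _ _ _ _, ← represents_flag hF _ _ _ _] at h
  exact h

end LocalCoordinates

/-! ### Finsler manifolds -/

section Manifold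

variable {n : ℕ} {M : Type*} [TopologicalSpace M] [ChartedSpace (Coord n) M]
  [IsManifold (𝓡 n) ∞ M]

omit [IsManifold (𝓡 n) ∞ M] in
lemma mfderiv_symm_ne_zero {φ : OpenPartialHomeomorph M (Coord n)}
    (hφ : φ ∈ IsManifold.maximalAtlas (𝓡 n) ∞ M) {x : Coord n} (hx : x ∈ φ.target)
    {y : Coord n} (hy : y ≠ 0) : mfderiv (𝓡 n) (𝓡 n) φ.symm x y ≠ 0 := by
  have h : φ.MDifferentiable (𝓡 n) (𝓡 n) :=
    ⟨(contMDiffOn_of_mem_maximalAtlas hφ).mdifferentiableOn (by simp),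
      (contMDiffOn_symm_of_mem_maximalAtlas hφ).mdifferentiableOn (by simp)⟩
  intro h0
  refine hy (h.symm.mfderiv_injective hx ?_)
  exact h0.trans (mfderiv (𝓡 n) (𝓡 n) φ.symm x).map_zero.symm

lemma isLocalMetric_localRep (F : FinslerMetric n M) {φ : OpenPartialHomeomorph M (Coord n)}
    (hφ : φ ∈ IsManifold.maximalAtlas (𝓡 n) ∞ M) :
    IsLocalMetric ⟨φ.target, φ.open_target⟩ (localRep F.toFun φ) where
  homogeneous x hx y hy t ht := by
    have h : mfderiv (𝓡 n) (𝓡 n) φ.symm x (t • y) = t • mfderiv (𝓡 n) (𝓡 n) φ.symm x y :=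
      (mfderiv (𝓡 n) (𝓡 n) φ.symm x).map_smul t y
    rw [localRep, h]
    exact F.homogeneous _ _ t ht
  posDef := F.convex φ hφ
  smooth := by
    set V : Set (TangentBundle (𝓡 n) (Coord n)) :=
      Bundle.TotalSpace.proj ⁻¹' φ.target
    have h1 : ContMDiffOn (𝓡 n).tangent (𝓡 n).tangent ∞
        (tangentMapWithin (𝓡 n) (𝓡 n) φ.symm φ.target) V :=
      (contMDiffOn_symm_of_mem_maximalAtlas hφ).contMDiffOn_tangentMapWithin
        (m := ∞) (by simp) φ.open_target.uniqueMDiffOn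
    have h2 : ContMDiff (𝓡 n).tangent (𝓡 n).tangent ∞
      ((tangentBundleModelSpaceHomeomorph (𝓡 n)).symm :
        ModelProd (Coord n) (Coord n) → TangentBundle (𝓡 n) (Coord n)) :=
      contMDiff_tangentBundleModelSpaceHomeomorph_symm
    have hW : ∀ p ∈ V, tangentMapWithin (𝓡 n) (𝓡 n) φ.symm φ.target p =
        (⟨φ.symm p.1, mfderiv (𝓡 n) (𝓡 n) φ.symm p.1 p.2⟩ : TangentBundle (𝓡 n) M) :=
      fun p hp => by
        rw [tangentMapWithin, mfderivWithin_of_isOpen φ.open_target hp]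
    have h3 : ContMDiffOn (𝓡 n).tangent 𝓘(ℝ, ℝ) ∞
        (fun p : ModelProd (Coord n) (Coord n) => localRep F.toFun φ p.1 p.2)
        {p | p.1 ∈ φ.target ∧ p.2 ≠ 0} := by
      refine (F.smooth.comp (h1.comp h2.contMDiffOn (s := {p | p.1 ∈ φ.target ∧ p.2 ≠ 0})
        fun p hp => hp.1) (fun p hp => ?_)).congr fun p hp => ?_
      · rw [Set.mem_preimage, Function.comp_apply, hW _ hp.1]
        exact mfderiv_symm_ne_zero hφ hp.1 hp.2
      · rw [Function.comp_apply, Function.comp_apply, hW _ hp.1]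
        rfl
    rw [← contMDiffOn_iff_contDiffOn, modelWithCornersSelf_prod]
    exact h3

end Manifold

end Finsler

end

theorem mainTheorem4 {n : ℕ} {M : Type*} [TopologicalSpace M]
    [ChartedSpace (Finsler.Coord n) M] [IsManifold (𝓡 n) ∞ M] [MeasurableSpace M] [BorelSpace M]
    (F : Finsler.FinslerMetric n M) (μ : Finsler.SmoothMeasure n M)
    (hsol : Finsler.IsEssentialGradientRicciSoliton F μ (1 / 2))
    (φ : OpenPartialHomeomorph M (Finsler.Coord n))
    (hφ : φ ∈ IsManifold.maximalAtlas (𝓡 n) ∞ M)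
    (x : Finsler.Coord n) (hx : x ∈ φ.target) (y : Finsler.Coord n) (hy : y ≠ 0) (m : Fin n)
    (L τ : Finsler.LocalFun n) (hL : L = Finsler.localRep F.toFun φ)
    (hτ : τ = Finsler.distortion L (μ.density φ)) :
    1 / 2 * Finsler.hd L m
        (fun x y => Finsler.scalarCurv L x y + Finsler.hgradNormSq L τ x y - τ x y) x y
      + ∑ i, Finsler.hgrad L τ i x y *
          ∑ t, ∑ s, (Finsler.cartanUp L t m s x y * Finsler.flag L s t i x y
            - Finsler.cartanUp L t i s x y * Finsler.flag L s t m x y)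
      = Finsler.keyForm L m x y := by
  subst hL hτ
  exact Finsler.soliton_identity_local (Finsler.isLocalMetric_localRep F hφ) (μ.smooth φ hφ)
    (μ.pos φ hφ) (hsol φ hφ) hx hy m
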